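/- Setting. Let $\mathbb N=\{1,2,\dots\}$, $\mathbb N_0=\mathbb N\cup\{0\}$, let $\mathbb N_0^{<\infty}$ be the set of finitely supported sequences in $\mathbb N_0^{\mathbb N}$, and put $\mathcal J=\mathcal K=\{(a,m):a\in\{0,1\},\,m\in\mathbb N_0^{<\infty}\}\setminus\{(1,0)\}$. Write $|m|=\max_{\ell\ge1}\ell^2m_\ell$ and $|j|=|m|$ for $j=(a,m)$. For $s_X,s_Y>0$ let $$\theta_{jk}=\exp(s_X|j|^{1/2})\vee\exp(s_Y|k|^{1/2})\ \text{ if } |j|\wedge|k|>0,\qquad \theta_{jk}=\infty\ \text{ if } |j|=0 \text{ or } |k|=0 .$$ For $t\ge0$ let $M(t)=\exp\bigl(\sum_{\ell\ge1}\log(1+\lfloor t/\ell^2\rfloor)\bigr)-1$, and for $t>0$ let $$m_{0,s_X,s_Y}(t)=\min\Bigl\{m\in\mathbb N:\ M\Bigl(\tfrac{\log^2(t/m^{1/2})}{4s_X^2}\Bigr)M\Bigl(\tfrac{\log^2(t/m^{1/2})}{4s_Y^2}\Bigr)<\tfrac m4\Bigr\}$$ (the set is non-empty for all sufficiently large $t$).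 Let $(\mathcal X,\mu_X)$, $(\mathcal Y,\mu_Y)$ be $\sigma$-finite measure spaces with orthonormal bases $(p^X_j)_{j\in\mathcal J}$ of $L^2(\mu_X)$ and $(p^Y_k)_{k\in\mathcal K}$ of $L^2(\mu_Y)$; put $\mu=\mu_X\otimes\mu_Y$. Let $\mathcal F$ be the set of $f\in L^2(\mu)$ with $f\ge0$ $\mu$-a.e. and $\int f\,d\mu=1$, with marginals $f_X(x)=\int f(x,y)\,d\mu_Y(y)$, $f_Y(y)=\int f(x,y)\,d\mu_X(x)$. Put $a_{jk}=\int f\,p^X_jp^Y_k\,d\mu$, $a_{j\bullet}=\int f_Xp^X_j\,d\mu_X$, $a_{\bullet k}=\int f_Yp^Y_k\,d\mu_Y$, $D(f)=\int(f(x,y)-f_X(x)f_Y(y))^2\,d\mu(x,y)$ and $S_\theta(f)=\sum_{j,k}\theta_{jk}^2(a_{jk}-a_{j\bullet}a_{\bullet k})^2$ (with $\infty\cdot0=0$). For $r,A,\rho>0$ and $\xi=(\theta,r,A)$ let $\mathcal F_\xi(\rho)$ be the set of $f\in\mathcal F$ with $D(f)\ge\rho^2$, $S_\theta(f)\le r^2$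 and $\max(\|f\|_\infty,\|f_X\|_\infty,\|f_Y\|_\infty)\le A$. Let $\Psi(\alpha)$ be the set of measurable $\psi:(\mathcal X\times\mathcal Y)^n\to[0,1]$ such that $\mathbb E_P\psi\le\alpha$ whenever the $n$ observed pairs are i.i.d. with a distribution $P$ on $\mathcal X\times\mathcal Y$ under which the two components are independent. Writing $\mathbb E_f$ for expectation when the pairs are i.i.d. with density $f$, let $$\mathcal R(n,\alpha,\xi,\rho)=\alpha+\inf_{\psi\in\Psi(\alpha)}\ \sup_{f\in\mathcal F_\xi(\rho)}\mathbb E_f(1-\psi)$$ (equal to $\alpha$ if $\mathcal F_\xi(\rho)=\emptyset$), and $\rho^*(n,\alpha,\beta,\xi)=\inf\{\rho>0:\mathcal R(n,\alpha,\xi,\rho)\le\alpha+\beta\}$. Claim. (i) Let $\alpha,\beta\in(0,1)$ with $\alpha+\beta<1$ and $s_X,s_Y,A>0$. There is $C=C(\alpha,\beta,s_X,s_Y,A)>0$ such that for all measure spaces and bases as above, all $r>0$ and all $n\ge16$ with $nr^2\ge C$, $$\rho^*(n,\alpha,\beta,\xi)\ \le\ \frac{C\,m_{0,s_X,s_Y}(nr^2)^{1/4}}{n^{1/2}}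 .$$ (ii) Let $s_X,s_Y>0$, $s=2/(s_X^{-1}+s_Y^{-1})$ and $\epsilon\in(0,4s)$. There is $C'=C'(s_X,s_Y,\epsilon)>0$ such that for all $t\ge C'$, $$t^{\frac{2c_0-\epsilon}{2s+c_0}}\ \le\ m_{0,s_X,s_Y}(t)\ \le\ t^{\frac{2c_0+\epsilon}{2s+c_0}},$$ where $c_0=\sum_{\ell=1}^\infty\{\ell^{-1/2}-(\ell+1)^{-1/2}\}\log(1+\ell)$; this series converges and $c_0=2.16\ldots$, i.e. $2.16\le c_0<2.17$. -/

import Mathlib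

open MeasureTheory ProbabilityTheory
open scoped ENNReal

noncomputable section

namespace IndepTest

/-! ### Densities, marginals, and the measure of dependence -/

section General

variable {X Y : Type*} [MeasurableSpace X] [MeasurableSpace Y]

/-- The set `𝓕` of square-integrable probability densities on `X × Y` with respect to `μX ⊗ μY`. -/
def densities (μX : Measure X) (μY : Measure Y) : Set (X × Y → ℝ) :=
  {f | MemLp f 2 (μX.prod μY) ∧ 0 ≤ᵐ[μX.prod μY] f ∧ ∫ z, f z ∂(μX.prod μY) = 1}

/-- The marginal density `f_X(x) = ∫ f(x, y) dμY(y)`. -/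
def margX (μY : Measure Y) (f : X × Y → ℝ) (x : X) : ℝ := ∫ y, f (x, y) ∂μY

/-- The marginal density `f_Y(y) = ∫ f(x, y) dμX(x)`. -/
def margY (μX : Measure X) (f : X × Y → ℝ) (y : Y) : ℝ := ∫ x, f (x, y) ∂μX

/-- The measure of dependence `D(f) = ∫ (f(x, y) - f_X(x) f_Y(y))² dμ(x, y)`. -/
def dependence (μX : Measure X) (μY : Measure Y) (f : X × Y → ℝ) : ℝ :=
  ∫ z, (f z - margX μY f z.1 * margY μX f z.2) ^ 2 ∂(μX.prod μY)

variable {J K : Type*}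

/-- The coefficient `a_{jk}(f) = ∫ f(x, y) p_j(x) q_k(y) dμ(x, y)`. -/
def coeff {μX : Measure X} {μY : Measure Y}
    (p : HilbertBasis J ℝ (Lp ℝ 2 μX)) (q : HilbertBasis K ℝ (Lp ℝ 2 μY))
    (f : X × Y → ℝ) (j : J) (k : K) : ℝ :=
  ∫ z, f z * (p j z.1 * q k z.2) ∂(μX.prod μY)

/-- The coefficient `a_{j•}(f) = ∫ f_X p_j dμX`. -/
def coeffX {μX : Measure X} (μY : Measure Y) (p : HilbertBasis J ℝ (Lp ℝ 2 μX))
    (f : X × Y → ℝ) (j : J) : ℝ :=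
  ∫ x, margX μY f x * p j x ∂μX

/-- The coefficient `a_{•k}(f) = ∫ f_Y q_k dμY`. -/
def coeffY (μX : Measure X) {μY : Measure Y} (q : HilbertBasis K ℝ (Lp ℝ 2 μY))
    (f : X × Y → ℝ) (k : K) : ℝ :=
  ∫ y, margY μX f y * q k y ∂μY

/-- The smoothness functional `S_θ(f) = ∑_{j,k} θ_{jk}² (a_{jk} - a_{j•} a_{•k})²`, in `[0, ∞]`,
with the convention `∞ · 0 = 0`. -/
def smoothness {μX : Measure X} {μY : Measure Y}
    (p : HilbertBasis J ℝ (Lp ℝ 2 μX)) (q : HilbertBasis K ℝ (Lp ℝ 2 μY))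
    (θ : J → K → ℝ≥0∞) (f : X × Y → ℝ) : ℝ≥0∞ :=
  ∑' j, ∑' k, θ j k ^ 2 *
    ENNReal.ofReal ((coeff p q f j k - coeffX μY p f j * coeffY μX q f k) ^ 2)

/-- The class of alternatives `𝓕_ξ(ρ)` for `ξ = (θ, r, A)`. -/
def alternatives {μX : Measure X} {μY : Measure Y}
    (p : HilbertBasis J ℝ (Lp ℝ 2 μX)) (q : HilbertBasis K ℝ (Lp ℝ 2 μY))
    (θ : J → K → ℝ≥0∞) (r A ρ : ℝ) : Set (X × Y → ℝ) :=
  {f | f ∈ densities μX μY ∧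
    ρ ^ 2 ≤ dependence μX μY f ∧
    smoothness p q θ f ≤ ENNReal.ofReal (r ^ 2) ∧
    (∀ z, |f z| ≤ A) ∧ (∀ x, |margX μY f x| ≤ A) ∧ (∀ y, |margY μX f y| ≤ A)}

/-! ### Tests, minimax risk and minimax separation -/

/-- `𝔼_P(g)` for a `[0, ∞)`-valued function `g` of `n` i.i.d. pairs with common distribution `P`. -/
def expect {n : ℕ} (P : Measure (X × Y)) (g : (Fin n → X × Y) → ℝ) : ℝ≥0∞ :=
  ∫⁻ z, ENNReal.ofReal (g z) ∂(Measure.pi fun _ : Fin n => P)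

/-- The null space: all laws of pairs with independent components. -/
def nullLaws (X Y : Type*) [MeasurableSpace X] [MeasurableSpace Y] : Set (Measure (X × Y)) :=
  {P | IsProbabilityMeasure P ∧ IndepFun Prod.fst Prod.snd P}

/-- The set `Ψ(α)` of randomised independence tests of size at most `α`, based on `n` pairs. -/
def tests (X Y : Type*) [MeasurableSpace X] [MeasurableSpace Y] (n : ℕ) (α : ℝ) :
    Set ((Fin n → X × Y) → ℝ) :=
  {ψ | Measurable ψ ∧ (∀ z, ψ z ∈ Set.Icc (0 : ℝ) 1) ∧
    ⨆ P ∈ nullLaws X Y, expect P ψ ≤ ENNReal.ofReal α}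

/-- The distribution on `X × Y` with density `f` with respect to `μX ⊗ μY`. -/
def densityLaw (μX : Measure X) (μY : Measure Y) (f : X × Y → ℝ) : Measure (X × Y) :=
  (μX.prod μY).withDensity fun z => ENNReal.ofReal (f z)

/-- The minimax risk `𝓡(n, α, ξ, ρ)`. It equals `α` if there are no alternatives, because a
supremum over the empty set is `0` in `[0, ∞]`. -/
def minimaxRisk {μX : Measure X} {μY : Measure Y}
    (p : HilbertBasis J ℝ (Lp ℝ 2 μX)) (q : HilbertBasis K ℝ (Lp ℝ 2 μY))
    (n : ℕ) (α : ℝ) (θ : J → K → ℝ≥0∞) (r A ρ : ℝ) : ℝ≥0∞ :=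
  ENNReal.ofReal α + ⨅ ψ ∈ tests X Y n α, ⨆ f ∈ alternatives p q θ r A ρ,
    expect (densityLaw μX μY f) fun z => 1 - ψ z

/-- The minimax separation radius `ρ*(n, α, β, ξ)`, in `[0, ∞]` (so that the infimum of the empty
set would be `∞`). -/
def separation {μX : Measure X} {μY : Measure Y}
    (p : HilbertBasis J ℝ (Lp ℝ 2 μX)) (q : HilbertBasis K ℝ (Lp ℝ 2 μY))
    (n : ℕ) (α β : ℝ) (θ : J → K → ℝ≥0∞) (r A : ℝ) : ℝ≥0∞ :=
  ⨅ (ρ : ℝ) (_ : 0 < ρ) (_ : minimaxRisk p q n α θ r A ρ ≤ ENNReal.ofReal (α + β)),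
    ENNReal.ofReal ρ

end General

/-! ### The infinite-dimensional index set and weights -/

/-- The index set `{(a, m) : a ∈ {0, 1}, m ∈ ℕ₀^{<∞}} \ {(1, 0)}`; finitely supported sequences are
indexed by the positive integers. -/
abbrev Idx : Type := {j : Fin 2 × (ℕ+ →₀ ℕ) // j ≠ (1, 0)}

/-- `|m| = max_ℓ ℓ² m_ℓ`. -/
def seqSize (m : ℕ+ →₀ ℕ) : ℕ := m.support.sup fun ℓ => (ℓ : ℕ) ^ 2 * m ℓ

/-- `|j| = |m|` for `j = (a, m)`. -/
def Idx.size (j : Idx) : ℕ := seqSize j.1.2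

/-- `θ_{jk} = exp(s_X |j|^{1/2}) ∨ exp(s_Y |k|^{1/2})` if `|j| ∧ |k| > 0`, and `θ_{jk} = ∞`
otherwise. -/
def weight (sX sY : ℝ) (j k : Idx) : ℝ≥0∞ :=
  if 0 < min j.size k.size then
    ENNReal.ofReal (max (Real.exp (sX * √(j.size : ℝ))) (Real.exp (sY * √(k.size : ℝ))))
  else ⊤

/-- `M(t) = exp(∑_{ℓ ≥ 1} log(1 + ⌊t / ℓ²⌋)) - 1` for `t ≥ 0`; the sum has finitely many non-zero
terms. -/
def countM (t : ℝ) : ℝ :=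
  Real.exp (∑' ℓ : ℕ+, Real.log (1 + (⌊t / (ℓ : ℝ) ^ 2⌋₊ : ℝ))) - 1

/-- `m_{0,s_X,s_Y}(t)`: the least positive integer `m` with
`M(log²(t / m^{1/2}) / (4 s_X²)) M(log²(t / m^{1/2}) / (4 s_Y²)) < m / 4`. -/
def mZero (sX sY t : ℝ) : ℕ :=
  sInf {m : ℕ | 1 ≤ m ∧
    countM (Real.log (t / √(m : ℝ)) ^ 2 / (4 * sX ^ 2)) *
      countM (Real.log (t / √(m : ℝ)) ^ 2 / (4 * sY ^ 2)) < (m : ℝ) / 4}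

/-- The summand `(ℓ^{-1/2} - (ℓ+1)^{-1/2}) log(1 + ℓ)` of the series for `c₀`. -/
def cZeroTerm (ℓ : ℕ+) : ℝ :=
  (1 / √(ℓ : ℝ) - 1 / √((ℓ : ℝ) + 1)) * Real.log (1 + (ℓ : ℝ))

/-- `c₀ = ∑_{ℓ ≥ 1} (ℓ^{-1/2} - (ℓ+1)^{-1/2}) log(1 + ℓ)`. -/
def cZero : ℝ := ∑' ℓ : ℕ+, cZeroTerm ℓ

end IndepTest

end

set_option linter.unusedSectionVars false

open Filter Topology

/-! The test flips signs of antisymmetrised pairs. Two observations (x, y), (x', y') give the vector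
of (p_j(x) - p_j(x'))(q_k(y) - q_k(y'))/2 over a finite set S of index pairs. Exchanging y and y'
reverses its sign and, under independence, preserves the law of the pair, so the vector is symmetric
under every null law (`map_kernelVec_neg`). Under a density f its mean is δ_jk = a_jk - a_j• a_•k,
and its second moment in direction w is at most 2(A + A²)|w|² (`kernelVec_moments`).

For symmetric real variables, rejecting when Σ u_i² < α(Σ u_i)² has level α: random signs give (Σ
ε_i u_i)² the mean Σ u_i², and Markov's inequality applies (`measure_selfNormRegion_le`). Vector
data are reduced to real data by splitting: one half is summed to a direction w, the other half is
projected onto w, and the level holds conditionally on w. Since w·δ ≈ N|δ|² and E|w|² ≲ N|S| +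
N²|δ|², the type II error is at most β once N|δ|² ≳ |S|^{1/2} (`measure_vectorRegion_compl_le`).

By Parseval D(f) = Σ δ_jk², and dropping indices with θ_jk ≥ τ costs at most r²/τ². Put t = nr², m =
m₀(t) and τ² = t/m^{1/2}: the bias is m^{1/2}/n, and by the definition of m₀ fewer than m indices
remain (`exists_truncation`). Bias and noise are both of order m^{1/2}/n, so a squared radius of
this order suffices (`separation_le`).

For the growth of m₀, Abel summation gives c₀ = Σ k^{-1/2} log(1 + 1/k), while exchanging sums gives
log(M(t) + 1) = Σ ⌊(t/k)^{1/2}⌋ log(1 + 1/k) ~ c₀ t^{1/2}. To leading order the condition on m reads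
(c₀/s)(log t - (log m)/2) < log m, that is, log m > (2c₀/(2s + c₀)) log t (`mZero_growth`). -/

namespace IndepTest

/-! ### The constant `c₀` -/

/-- The summand of the rearranged series `c₀ = ∑_{k ≥ 1} k^{-1/2} log(1 + 1/k)`, shifted to start
at `0`. -/
noncomputable def logTerm (k : ℕ) : ℝ :=
  (Real.log ((k : ℝ) + 2) - Real.log ((k : ℝ) + 1)) / √((k : ℝ) + 1)

lemma log_diff_nonneg (k : ℕ) : 0 ≤ Real.log ((k : ℝ) + 2) - Real.log ((k : ℝ) + 1) :=
  sub_nonneg.2 (Real.log_le_log (by positivity) (by linarith))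

lemma logTerm_nonneg (k : ℕ) : 0 ≤ logTerm k :=
  div_nonneg (log_diff_nonneg k) (Real.sqrt_nonneg _)

lemma log_diff_eq (k : ℕ) : Real.log ((k : ℝ) + 2) - Real.log ((k : ℝ) + 1) =
    2 * Real.log (√((k : ℝ) + 2) / √((k : ℝ) + 1)) := by
  rw [Real.log_div (by positivity) (by positivity), Real.log_sqrt (by positivity),
    Real.log_sqrt (by positivity)]
  ring

/-- This is `1 - v⁻¹ ≤ log v` at v = √((k+2)/(k+1)); the square root makes the bound telescope. -/
lemma logTerm_lower (k : ℕ) : 2 / √((k : ℝ) + 1) - 2 / √((k : ℝ) + 2) ≤ logTerm k := by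
  have h1 : 0 < √((k : ℝ) + 1) := by positivity
  have h2 : 0 < √((k : ℝ) + 2) := by positivity
  have h := Real.one_sub_inv_le_log_of_pos (div_pos h2 h1)
  rw [logTerm, log_diff_eq, le_div_iff₀ h1]
  refine le_trans (le_of_eq ?_) (mul_le_mul_of_nonneg_left h zero_le_two)
  field_simp

/-- This is `x ≤ sinh x` at x = log v. -/
lemma log_sq_le {v : ℝ} (hv : 1 ≤ v) : 2 * Real.log v ≤ v - v⁻¹ := by
  have hv0 : 0 < v := by linarith
  have h := Real.self_le_sinh_iff.2 (Real.log_nonneg hv)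
  rw [Real.sinh_eq, Real.exp_neg, Real.exp_log hv0] at h
  linarith

/-- The intermediate bound is 1/((k+1)√(k+2)). The shift 3/4 keeps the majorant telescoping and
leaves a tail bound sharp enough for `cZero_lt`. -/
lemma logTerm_upper (k : ℕ) :
    logTerm k ≤ 2 / √((k : ℝ) + 3 / 4) - 2 / √((k : ℝ) + 7 / 4) := by
  have hk : (0 : ℝ) ≤ k := k.cast_nonneg
  have h1 : 0 < √((k : ℝ) + 1) := by positivity
  have h2 : 0 < √((k : ℝ) + 2) := by positivity
  have s1 : √((k : ℝ) + 1) ^ 2 = k + 1 := Real.sq_sqrt (by positivity)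
  have s2 : √((k : ℝ) + 2) ^ 2 = k + 2 := Real.sq_sqrt (by positivity)
  have hv : 1 ≤ √((k : ℝ) + 2) / √((k : ℝ) + 1) :=
    (one_le_div h1).2 (Real.sqrt_le_sqrt (by linarith))
  have h := log_sq_le hv
  have hA : logTerm k ≤ 1 / (((k : ℝ) + 1) * √((k : ℝ) + 2)) := by
    rw [logTerm, log_diff_eq, div_le_iff₀ h1]
    refine h.trans (le_of_eq ?_)
    field_simp
    rw [s1, s2]; ring
  refine hA.trans ?_
  have ha : 0 < √((k : ℝ) + 3 / 4) := by positivity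
  have hb : 0 < √((k : ℝ) + 7 / 4) := by positivity
  set a := √((k : ℝ) + 3 / 4) with hadef
  set b := √((k : ℝ) + 7 / 4) with hbdef
  have sa : a ^ 2 = k + 3 / 4 := Real.sq_sqrt (by positivity)
  have sb : b ^ 2 = k + 7 / 4 := Real.sq_sqrt (by positivity)
  have hab : a * b ≤ k + 5 / 4 := by nlinarith [sq_nonneg (a - b)]
  have key : 2 / a - 2 / b = 2 / (a * b * (a + b)) := by
    have : (b - a) * (a + b) = 1 := by nlinarith
    field_simp
    nlinarith
  rw [key, div_le_div_iff₀ (by positivity) (by positivity), one_mul]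
  have hsum : (a + b) ^ 2 ≤ 4 * (k + 5 / 4) := by nlinarith
  have hsq : (a * b * (a + b)) ^ 2 ≤ (2 * (((k : ℝ) + 1) * √((k : ℝ) + 2))) ^ 2 := by
    have e1 : (a * b * (a + b)) ^ 2 = (k + 3 / 4) * (k + 7 / 4) * (a + b) ^ 2 := by
      rw [← sa, ← sb]; ring
    have e2 : (2 * (((k : ℝ) + 1) * √((k : ℝ) + 2))) ^ 2 = 4 * (k + 1) ^ 2 * (k + 2) := by
      rw [mul_pow, mul_pow, s2]; ring
    rw [e1, e2]
    calc _ ≤ ((k : ℝ) + 3 / 4) * (k + 7 / 4) * (4 * (k + 5 / 4)) := by gcongr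
      _ ≤ _ := by nlinarith [mul_nonneg hk hk]
  exact le_of_sq_le_sq hsq (by positivity)

lemma sum_logTerm_le (n : ℕ) (m : ℕ) :
    ∑ k ∈ Finset.range (n + m), logTerm k ≤
      ∑ k ∈ Finset.range n, logTerm k + 2 / √((n : ℝ) + 3 / 4)
        - 2 / √(((n + m : ℕ) : ℝ) + 3 / 4) := by
  induction m with
  | zero => simp
  | succ m ih =>
    rw [← add_assoc, Finset.sum_range_succ]
    have := logTerm_upper (n + m)
    have e : (((n + m + 1 : ℕ) : ℝ) + 3 / 4) = ((n + m : ℕ) : ℝ) + 7 / 4 := by push_cast; ring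
    rw [e]; linarith

lemma le_sum_logTerm (n : ℕ) (m : ℕ) :
    ∑ k ∈ Finset.range n, logTerm k + 2 / √((n : ℝ) + 1)
        - 2 / √(((n + m : ℕ) : ℝ) + 1) ≤ ∑ k ∈ Finset.range (n + m), logTerm k := by
  induction m with
  | zero => simp
  | succ m ih =>
    rw [← add_assoc, Finset.sum_range_succ]
    have := logTerm_lower (n + m)
    have e : (((n + m + 1 : ℕ) : ℝ) + 1) = ((n + m : ℕ) : ℝ) + 2 := by push_cast; ring
    rw [e]; linarith

lemma summable_logTerm : Summable logTerm := by
  refine summable_of_sum_range_le (c := 2 / √((0 : ℕ) + 3 / 4 : ℝ)) logTerm_nonneg fun n => ?_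
  have := sum_logTerm_le 0 n
  have h2 : 0 ≤ 2 / √(((0 + n : ℕ) : ℝ) + 3 / 4) := by positivity
  rw [zero_add] at this h2
  simp only [Finset.range_zero, Finset.sum_empty] at this
  linarith

lemma tsum_logTerm_le (n : ℕ) :
    ∑' k, logTerm k ≤ ∑ k ∈ Finset.range n, logTerm k + 2 / √((n : ℝ) + 3 / 4) := by
  refine summable_logTerm.tsum_le_of_sum_range_le fun m => ?_
  have h1 : ∑ k ∈ Finset.range m, logTerm k ≤ ∑ k ∈ Finset.range (n + m), logTerm k :=
    Finset.sum_le_sum_of_subset_of_nonneg (Finset.range_mono (by lia))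
      fun _ _ _ => logTerm_nonneg _
  have h2 := sum_logTerm_le n m
  have h3 : 0 ≤ 2 / √(((n + m : ℕ) : ℝ) + 3 / 4) := by positivity
  linarith

lemma tendsto_inv_sqrt_shift (n : ℕ) :
    Tendsto (fun m : ℕ => 2 / √(((n + m : ℕ) : ℝ) + 1)) atTop (𝓝 0) := by
  refine Tendsto.div_atTop tendsto_const_nhds (Real.tendsto_sqrt_atTop.comp ?_)
  refine tendsto_atTop_add_const_right _ _ (tendsto_natCast_atTop_atTop.comp ?_)
  exact tendsto_add_atTop_nat n |>.congr fun m => add_comm _ _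

lemma le_tsum_logTerm (n : ℕ) :
    ∑ k ∈ Finset.range n, logTerm k + 2 / √((n : ℝ) + 1) ≤ ∑' k, logTerm k := by
  have h := (tendsto_inv_sqrt_shift n).const_sub
    (∑ k ∈ Finset.range n, logTerm k + 2 / √((n : ℝ) + 1))
  rw [sub_zero] at h
  exact le_of_tendsto' h fun m => (le_sum_logTerm n m).trans
    (summable_logTerm.sum_le_tsum _ fun _ _ => logTerm_nonneg _)

lemma cZeroTerm_succ (k : ℕ) : cZeroTerm k.succPNat =
    (1 / √((k : ℝ) + 1) - 1 / √((k : ℝ) + 2)) * Real.log ((k : ℝ) + 2) := by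
  rw [cZeroTerm, Nat.succPNat_coe]
  push_cast
  rw [show (k : ℝ) + 1 + 1 = k + 2 by ring, show (1 : ℝ) + (k + 1) = k + 2 by ring]

/-- Summation by parts. The boundary term tends to zero, so the two series have the same sum. -/
lemma sum_cZeroTerm (n : ℕ) : ∑ k ∈ Finset.range n, cZeroTerm k.succPNat =
    ∑ k ∈ Finset.range n, logTerm k - Real.log ((n : ℝ) + 1) / √((n : ℝ) + 1) := by
  induction n with
  | zero => simp
  | succ n ih =>
    rw [Finset.sum_range_succ, Finset.sum_range_succ, ih, cZeroTerm_succ, logTerm]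
    push_cast
    rw [show (n : ℝ) + 1 + 1 = n + 2 by ring]
    ring

lemma cZeroTerm_nonneg (k : ℕ) : 0 ≤ cZeroTerm k.succPNat := by
  rw [cZeroTerm_succ]
  refine mul_nonneg (sub_nonneg.2 ?_) (Real.log_nonneg (by linarith [k.cast_nonneg (α := ℝ)]))
  exact one_div_le_one_div_of_le (by positivity) (Real.sqrt_le_sqrt (by linarith))

lemma tendsto_log_div_sqrt :
    Tendsto (fun n : ℕ => Real.log ((n : ℝ) + 1) / √((n : ℝ) + 1)) atTop (𝓝 0) := by
  have h := (isLittleO_log_rpow_atTop (r := 1 / 2) (by norm_num)).tendsto_div_nhds_zero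
  have h2 : Tendsto (fun n : ℕ => (n : ℝ) + 1) atTop atTop :=
    tendsto_atTop_add_const_right _ _ tendsto_natCast_atTop_atTop
  refine (h.comp h2).congr fun n => ?_
  simp [Real.sqrt_eq_rpow]

lemma hasSum_cZeroTerm : HasSum cZeroTerm (∑' k, logTerm k) := by
  rw [← Equiv.pnatEquivNat.symm.hasSum_iff]
  change HasSum (fun k : ℕ => cZeroTerm k.succPNat) _
  rw [hasSum_iff_tendsto_nat_of_nonneg cZeroTerm_nonneg]
  simp_rw [sum_cZeroTerm]
  simpa using summable_logTerm.hasSum.tendsto_sum_nat.sub tendsto_log_div_sqrt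

lemma cZero_eq : cZero = ∑' k, logTerm k := hasSum_cZeroTerm.tsum_eq

lemma hasSum_logTerm : HasSum logTerm cZero := cZero_eq ▸ summable_logTerm.hasSum

lemma mul_le_logTerm {k : ℕ} {q : ℝ} (h : q ^ 2 * (k + 1) ≤ 1) :
    q * (Real.log ((k : ℝ) + 2) - Real.log ((k : ℝ) + 1)) ≤ logTerm k := by
  rw [logTerm, div_eq_mul_inv, mul_comm]
  refine mul_le_mul_of_nonneg_left ?_ (log_diff_nonneg k)
  rw [← one_div, le_div_iff₀ (by positivity)]
  refine le_of_sq_le_sq ?_ zero_le_one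
  rwa [mul_pow, Real.sq_sqrt (by positivity), one_pow]

lemma inv_sqrt_le {x q : ℝ} (hx : 0 < x) (hq : 0 ≤ q) (h : 1 ≤ q ^ 2 * x) : 1 / √x ≤ q := by
  rw [div_le_iff₀ (by positivity)]
  refine le_of_sq_le_sq ?_ (by positivity)
  rwa [mul_pow, Real.sq_sqrt hx.le, one_pow]

lemma logTerm_le_mul {k : ℕ} {q : ℝ} (hq : 0 ≤ q) (h : 1 ≤ q ^ 2 * (k + 1)) :
    logTerm k ≤ q * (Real.log ((k : ℝ) + 2) - Real.log ((k : ℝ) + 1)) := by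
  rw [logTerm, div_eq_mul_inv, mul_comm q]
  refine mul_le_mul_of_nonneg_left ?_ (log_diff_nonneg k)
  rw [← one_div]
  exact inv_sqrt_le (by positivity) hq h

/-- 7⁴ = 2401 lies between 2400 = 2⁵·3·5² and 2430 = 2·3⁵·5. -/
lemma log_seven_bounds : 5 * Real.log 2 + Real.log 3 + 2 * Real.log 5 ≤ 4 * Real.log 7 ∧
    4 * Real.log 7 ≤ Real.log 2 + 5 * Real.log 3 + Real.log 5 := by
  constructor
  · have h : Real.log (2 ^ 5 * 3 * 5 ^ 2) ≤ Real.log (7 ^ 4) :=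
      Real.log_le_log (by norm_num) (by norm_num)
    rw [Real.log_mul, Real.log_mul, Real.log_pow, Real.log_pow, Real.log_pow] at h <;> norm_num at *
    exact h
  · have h : Real.log (7 ^ 4) ≤ Real.log (2 * 3 ^ 5 * 5) :=
      Real.log_le_log (by norm_num) (by norm_num)
    rw [Real.log_mul, Real.log_mul, Real.log_pow, Real.log_pow] at h <;> norm_num at *
    exact h

lemma log_composite : Real.log 4 = 2 * Real.log 2 ∧ Real.log 6 = Real.log 2 + Real.log 3 ∧
    Real.log 8 = 3 * Real.log 2 ∧ Real.log 9 = 2 * Real.log 3 := by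
  refine ⟨Real.log_four_eq, ?_, ?_, ?_⟩
  · rw [← Real.log_mul] <;> norm_num
  · rw [show (8 : ℝ) = 2 ^ 3 by norm_num, Real.log_pow]; norm_num
  · rw [show (9 : ℝ) = 3 ^ 2 by norm_num, Real.log_pow]; norm_num

lemma le_cZero : 2.16 ≤ cZero := by
  rw [cZero_eq]
  -- After eight terms the tail bound is 2/√9, which is rational. The values `q` round 1/√(k+1)
  -- down; in `cZero_lt` they round it up.
  refine le_trans ?_ (le_tsum_logTerm 8)
  have h0 := mul_le_logTerm (k := 0) (q := 1) (by norm_num)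
  have h1 := mul_le_logTerm (k := 1) (q := 0.7071) (by norm_num)
  have h2 := mul_le_logTerm (k := 2) (q := 0.5773) (by norm_num)
  have h3 := mul_le_logTerm (k := 3) (q := 0.5) (by norm_num)
  have h4 := mul_le_logTerm (k := 4) (q := 0.4472) (by norm_num)
  have h5 := mul_le_logTerm (k := 5) (q := 0.4082) (by norm_num)
  have h6 := mul_le_logTerm (k := 6) (q := 0.3779) (by norm_num)
  have h7 := mul_le_logTerm (k := 7) (q := 0.3535) (by norm_num)
  have e9 : 2 / √(((8 : ℕ) : ℝ) + 1) = 2 / 3 := by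
    rw [show ((8 : ℕ) : ℝ) + 1 = 3 ^ 2 by norm_num, Real.sqrt_sq (by norm_num)]
  rw [e9]
  simp only [Finset.sum_range_succ, Finset.sum_range_zero]
  norm_num at h0 h1 h2 h3 h4 h5 h6 h7 ⊢
  obtain ⟨c4, c6, c8, c9⟩ := log_composite
  rw [c4] at h2 h3
  rw [c6] at h4 h5
  rw [c8] at h6 h7
  rw [c9] at h7
  linarith [log_seven_bounds.1, Real.log_two_gt_d9, Real.log_two_lt_d9, Real.log_three_gt_d9,
    Real.log_three_lt_d9, Real.log_five_gt_d9, Real.log_five_lt_d9]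

lemma cZero_lt : cZero < 2.17 := by
  rw [cZero_eq]
  refine (tsum_logTerm_le 9).trans_lt ?_
  have h0 := logTerm_le_mul (k := 0) (q := 1) (by norm_num) (by norm_num)
  have h1 := logTerm_le_mul (k := 1) (q := 0.70711) (by norm_num) (by norm_num)
  have h2 := logTerm_le_mul (k := 2) (q := 0.57736) (by norm_num) (by norm_num)
  have h3 := logTerm_le_mul (k := 3) (q := 0.5) (by norm_num) (by norm_num)
  have h4 := logTerm_le_mul (k := 4) (q := 0.44722) (by norm_num) (by norm_num)
  have h5 := logTerm_le_mul (k := 5) (q := 0.40825) (by norm_num) (by norm_num)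
  have h6 := logTerm_le_mul (k := 6) (q := 0.37797) (by norm_num) (by norm_num)
  have h7 := logTerm_le_mul (k := 7) (q := 0.35356) (by norm_num) (by norm_num)
  have h8 := logTerm_le_mul (k := 8) (q := 0.33334) (by norm_num) (by norm_num)
  have h9 : 1 / √(((9 : ℕ) : ℝ) + 3 / 4) ≤ 0.32026 :=
    inv_sqrt_le (by norm_num) (by norm_num) (by norm_num)
  rw [show 2 / √(((9 : ℕ) : ℝ) + 3 / 4) = 2 * (1 / √(((9 : ℕ) : ℝ) + 3 / 4)) by ring]
  simp only [Finset.sum_range_succ, Finset.sum_range_zero]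
  norm_num at h0 h1 h2 h3 h4 h5 h6 h7 h8 h9 ⊢
  obtain ⟨c4, c6, c8, c9⟩ := log_composite
  rw [c4] at h2 h3
  rw [c6] at h4 h5
  rw [c8] at h6 h7
  rw [c9] at h7 h8
  rw [Real.log_ten_eq] at h8
  linarith [log_seven_bounds.2, Real.log_two_gt_d9, Real.log_two_lt_d9, Real.log_three_gt_d9,
    Real.log_three_lt_d9, Real.log_five_gt_d9, Real.log_five_lt_d9]

/-! ### Asymptotics of `M` and `m₀` -/

/-- `log (M(t) + 1)`. -/
noncomputable def logCount (t : ℝ) : ℝ := ∑' ℓ : ℕ+, Real.log (1 + (⌊t / (ℓ : ℝ) ^ 2⌋₊ : ℝ))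

lemma countM_eq (t : ℝ) : countM t = Real.exp (logCount t) - 1 := rfl

lemma floor_div_sq_eq_zero {t : ℝ} {N ℓ : ℕ} (hN : t < N + 1) (hℓ : N ≤ ℓ) :
    ⌊t / ((ℓ : ℝ) + 1) ^ 2⌋₊ = 0 := by
  rw [Nat.floor_eq_zero, div_lt_one (by positivity)]
  have : (N : ℝ) ≤ ℓ := by exact_mod_cast hℓ
  nlinarith [ℓ.cast_nonneg (α := ℝ)]

lemma logCount_eq_sum {t : ℝ} {N : ℕ} (hN : t < N + 1) : logCount t =
    ∑ ℓ ∈ Finset.range N, Real.log (1 + (⌊t / ((ℓ : ℝ) + 1) ^ 2⌋₊ : ℝ)) := by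
  have h := tsum_pnat_eq_tsum_succ
    (f := fun n : ℕ => Real.log (1 + (⌊t / (n : ℝ) ^ 2⌋₊ : ℝ)))
  rw [logCount, h, tsum_eq_sum (s := Finset.range N)]
  · push_cast; rfl
  · intro ℓ hℓ
    rw [Finset.mem_range, not_lt] at hℓ
    push_cast
    rw [floor_div_sq_eq_zero hN hℓ]
    simp

lemma log_one_add_eq_sum (m : ℕ) : Real.log (1 + (m : ℝ)) =
    ∑ k ∈ Finset.range m, (Real.log ((k : ℝ) + 2) - Real.log ((k : ℝ) + 1)) := by
  induction m with
  | zero => simp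
  | succ m ih =>
    rw [Finset.sum_range_succ, ← ih]
    push_cast
    rw [show (1 : ℝ) + (m + 1) = m + 2 by ring, add_comm (1 : ℝ) m]
    ring

lemma sum_range_eq_sum_ite {m N : ℕ} (h : m ≤ N) (d : ℕ → ℝ) :
    ∑ k ∈ Finset.range m, d k = ∑ k ∈ Finset.range N, if k < m then d k else 0 := by
  rw [← Finset.sum_filter]
  congr 1
  ext k
  simp only [Finset.mem_range, Finset.mem_filter]
  lia

lemma lt_floor_div_sq_iff {t : ℝ} (ht : 0 ≤ t) (k ℓ : ℕ) :
    k < ⌊t / ((ℓ : ℝ) + 1) ^ 2⌋₊ ↔ ℓ < ⌊√(t / ((k : ℝ) + 1))⌋₊ := by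
  rw [← Nat.add_one_le_iff, Nat.le_floor_iff (by positivity), ← Nat.add_one_le_iff (n := ℓ),
    Nat.le_floor_iff (by positivity), Real.le_sqrt (by positivity) (by positivity),
    le_div_iff₀ (by positivity), le_div_iff₀ (by positivity)]
  push_cast
  rw [mul_comm]

/-- Each log(1 + ⌊t/ℓ²⌋) is a telescoping sum over k < ⌊t/ℓ²⌋. After exchanging the sums, the k-th
increment is counted once for each positive integer not exceeding √(t/(k+1)). -/
lemma logCount_eq_sum_floor_sqrt {t : ℝ} (ht : 0 ≤ t) {N : ℕ} (hN : t < N + 1) : logCount t =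
    ∑ k ∈ Finset.range N, (⌊√(t / ((k : ℝ) + 1))⌋₊ : ℝ) *
      (Real.log ((k : ℝ) + 2) - Real.log ((k : ℝ) + 1)) := by
  have hx : ∀ (x : ℝ) , x ≤ t → ⌊x⌋₊ ≤ N := fun x hx => by
    have : ⌊x⌋₊ < N + 1 := by
      rcases le_or_gt 0 x with h | h
      · rw [Nat.floor_lt h]; push_cast; linarith
      · rw [Nat.floor_of_nonpos h.le]; lia
    lia
  have h1 : ∀ ℓ ∈ Finset.range N, Real.log (1 + (⌊t / ((ℓ : ℝ) + 1) ^ 2⌋₊ : ℝ)) =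
      ∑ k ∈ Finset.range N, if k < ⌊t / ((ℓ : ℝ) + 1) ^ 2⌋₊ then
        Real.log ((k : ℝ) + 2) - Real.log ((k : ℝ) + 1) else 0 := fun ℓ _ => by
    rw [log_one_add_eq_sum, sum_range_eq_sum_ite]
    refine hx _ (div_le_self ht ?_)
    nlinarith [ℓ.cast_nonneg (α := ℝ)]
  rw [logCount_eq_sum hN, Finset.sum_congr rfl h1, Finset.sum_comm]
  refine Finset.sum_congr rfl fun k _ => ?_
  simp_rw [lt_floor_div_sq_iff ht]
  rw [← sum_range_eq_sum_ite, Finset.sum_const, Finset.card_range, nsmul_eq_mul]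
  have : ⌊√(t / ((k : ℝ) + 1))⌋₊ < N + 1 := by
    rw [Nat.floor_lt (by positivity), Real.sqrt_lt' (by positivity)]
    have h2 : t / ((k : ℝ) + 1) ≤ t := div_le_self ht (by linarith [k.cast_nonneg (α := ℝ)])
    push_cast
    nlinarith [N.cast_nonneg (α := ℝ)]
  lia

lemma logCount_nonneg {t : ℝ} : 0 ≤ logCount t :=
  tsum_nonneg fun _ => Real.log_nonneg (le_add_of_nonneg_right (Nat.cast_nonneg _))

lemma countM_nonneg {t : ℝ} : 0 ≤ countM t := by
  rw [countM_eq, sub_nonneg]; exact Real.one_le_exp logCount_nonneg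

lemma sqrt_div_mul_log_diff (t : ℝ) (k : ℕ) : √(t / ((k : ℝ) + 1)) *
    (Real.log ((k : ℝ) + 2) - Real.log ((k : ℝ) + 1)) = √t * logTerm k := by
  rw [Real.sqrt_div' _ (by positivity), logTerm]; ring

lemma logCount_le {t : ℝ} (ht : 0 ≤ t) : logCount t ≤ cZero * √t := by
  obtain ⟨N, hN⟩ := exists_nat_gt t
  rw [logCount_eq_sum_floor_sqrt ht (hN.trans (lt_add_one _))]
  calc _ ≤ ∑ k ∈ Finset.range N, √t * logTerm k := Finset.sum_le_sum fun k _ => by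
        rw [← sqrt_div_mul_log_diff]
        exact mul_le_mul_of_nonneg_right (Nat.floor_le (by positivity)) (log_diff_nonneg k)
    _ = (∑ k ∈ Finset.range N, logTerm k) * √t := by rw [← Finset.mul_sum, mul_comm]
    _ ≤ _ := mul_le_mul_of_nonneg_right
        (cZero_eq ▸ summable_logTerm.sum_le_tsum _ fun _ _ => logTerm_nonneg _)
        (Real.sqrt_nonneg _)

/-- Only the first K increments are kept. Each floor loses at most one, and the lost increments
telescope to log(1 + K). -/
lemma le_logCount {t : ℝ} (ht : 0 ≤ t) (K : ℕ) :
    (∑ k ∈ Finset.range K, logTerm k) * √t - Real.log (1 + (K : ℝ)) ≤ logCount t := by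
  obtain ⟨N, hN⟩ := exists_nat_gt t
  have hN' : t < ((max N K : ℕ) : ℝ) + 1 := by
    have : (N : ℝ) ≤ (max N K : ℕ) := by exact_mod_cast le_max_left _ _
    linarith
  rw [logCount_eq_sum_floor_sqrt ht hN', log_one_add_eq_sum, Finset.sum_mul,
    ← Finset.sum_sub_distrib]
  refine (Finset.sum_le_sum fun k _ => ?_).trans (Finset.sum_le_sum_of_subset_of_nonneg
    (Finset.range_mono (le_max_right N K)) fun k _ _ =>
      mul_nonneg (Nat.cast_nonneg _) (log_diff_nonneg k))
  rw [mul_comm (logTerm k), ← sqrt_div_mul_log_diff]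
  have := (Nat.sub_one_lt_floor (√(t / ((k : ℝ) + 1)))).le
  nlinarith [log_diff_nonneg k]

lemma exists_le_logCount {δ : ℝ} (hδ : 0 < δ) :
    ∃ C : ℝ, 0 ≤ C ∧ ∀ t, 0 ≤ t → (cZero - δ) * √t - C ≤ logCount t := by
  have h := (hasSum_logTerm.tendsto_sum_nat).eventually (lt_mem_nhds (sub_lt_self cZero hδ))
  obtain ⟨K, hK⟩ := h.exists
  refine ⟨Real.log (1 + (K : ℝ)), Real.log_nonneg (by simp), fun t ht => ?_⟩
  refine le_trans ?_ (le_logCount ht K)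
  gcongr

/-! ### Polynomial growth of `mZero`. -/

lemma cZero_pos : 0 < cZero := by linarith [le_cZero]

/-- The set of admissible `m` in the definition of `m₀`. -/
def mZeroSet (sX sY t : ℝ) : Set ℕ :=
  {m : ℕ | 1 ≤ m ∧ countM (Real.log (t / √(m : ℝ)) ^ 2 / (4 * sX ^ 2)) *
      countM (Real.log (t / √(m : ℝ)) ^ 2 / (4 * sY ^ 2)) < (m : ℝ) / 4}

lemma sqrt_sq_div {L σ : ℝ} (hL : 0 ≤ L) (hσ : 0 < σ) : √(L ^ 2 / (4 * σ ^ 2)) = L / (2 * σ) := by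
  rw [show L ^ 2 / (4 * σ ^ 2) = (L / (2 * σ)) ^ 2 by field_simp; ring]
  exact Real.sqrt_sq (by positivity)

lemma countM_le {L σ : ℝ} (hL : 0 ≤ L) (hσ : 0 < σ) :
    countM (L ^ 2 / (4 * σ ^ 2)) ≤ Real.exp (cZero * (L / (2 * σ))) := by
  have h := logCount_le (t := L ^ 2 / (4 * σ ^ 2)) (by positivity)
  rw [sqrt_sq_div hL hσ] at h
  rw [countM_eq]
  linarith [Real.exp_le_exp.2 h]

/-- The witness is ⌊t^b⌋, with b slightly above the exponent that balances the two sides of the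
defining inequality. -/
lemma exists_mem_mZeroSet {sX sY s ε : ℝ} (hX : 0 < sX) (hY : 0 < sY)
    (hs : s = 2 / (sX⁻¹ + sY⁻¹)) (hε : 0 < ε) (hε' : ε < 4 * s) :
    ∃ C' : ℝ, 0 < C' ∧ ∀ t : ℝ, C' ≤ t → ∃ m ∈ mZeroSet sX sY t,
      (m : ℝ) ≤ t ^ ((2 * cZero + ε) / (2 * s + cZero)) := by
  have hs0 : 0 < s := hs ▸ by positivity
  have hc := cZero_pos
  set b := (2 * cZero + ε) / (2 * s + cZero) with hb
  have hb0 : 0 < b := by positivity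
  -- This is where ε < 4s enters; b < 2 makes the logarithm `L` nonnegative.
  have hb2 : b < 2 := by rw [hb, div_lt_iff₀ (by positivity)]; linarith
  have hbeq : b - cZero / s * (1 - b / 2) = ε / (2 * s) := by
    rw [hb]; field_simp; ring
  -- The first threshold gives t^b ≥ 2, so the floor loses at most a factor 2. The second lets the
  -- surplus ε/(2s)·log t beat the constants: log 8 combines this factor with the 4 of m/4, and the
  -- other log 2 is the effect of the floor on `L`.
  set R := max (Real.log 2 / b)
    ((2 * s / ε) * (Real.log 8 + cZero / (2 * s) * Real.log 2 + 1)) with hR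
  refine ⟨Real.exp R, Real.exp_pos _, fun t ht => ?_⟩
  have ht0 : 0 < t := (Real.exp_pos _).trans_le ht
  have hlog : R ≤ Real.log t := (Real.le_log_iff_exp_le ht0).2 ht
  have htb : 2 ≤ t ^ b := by
    rw [← Real.log_le_log_iff two_pos (by positivity), Real.log_rpow ht0, mul_comm,
      ← div_le_iff₀ hb0]
    exact (le_max_left _ _).trans hlog
  have hm_le : (⌊t ^ b⌋₊ : ℝ) ≤ t ^ b := Nat.floor_le (by positivity)
  have hm_ge : t ^ b / 2 ≤ (⌊t ^ b⌋₊ : ℝ) := by linarith [Nat.sub_one_lt_floor (t ^ b)]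
  set m := ⌊t ^ b⌋₊
  have hm1 : (1 : ℝ) ≤ m := by linarith
  have hm0 : (0 : ℝ) < m := by linarith
  refine ⟨m, ⟨by exact_mod_cast hm1, ?_⟩, hm_le⟩
  set L := Real.log (t / √(m : ℝ)) with hL
  have hLeq : L = Real.log t - Real.log m / 2 := by
    rw [hL, Real.log_div (by positivity) (by positivity), Real.log_sqrt hm0.le]
  have hlm1 : Real.log m ≤ b * Real.log t := by
    rw [← Real.log_rpow ht0]; exact Real.log_le_log hm0 hm_le
  have hlm2 : b * Real.log t - Real.log 2 ≤ Real.log m := by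
    rw [← Real.log_rpow ht0, ← Real.log_div (by positivity) (by norm_num)]
    exact Real.log_le_log (by positivity) hm_ge
  have hR2 := (le_max_right _ _).trans hlog
  have hlt0 : 0 ≤ Real.log t := le_trans
    (le_trans (div_nonneg (Real.log_nonneg one_le_two) hb0.le) (le_max_left _ _)) hlog
  have hL0 : 0 ≤ L := by rw [hLeq]; nlinarith
  calc _ ≤ Real.exp (cZero * (L / (2 * sX))) * Real.exp (cZero * (L / (2 * sY))) :=
        mul_le_mul (countM_le hL0 hX) (countM_le hL0 hY) countM_nonneg (Real.exp_pos _).le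
    _ = Real.exp (cZero / s * L) := by
        rw [← Real.exp_add]; congr 1; rw [hs]; field_simp
    _ < Real.exp (Real.log (m / 4)) := by
        rw [Real.exp_lt_exp, Real.log_div hm0.ne' (by norm_num)]
        have e8 : Real.log 8 = Real.log 4 + Real.log 2 := by
          rw [← Real.log_mul] <;> norm_num
        have h1 : cZero / s * L ≤
            cZero / s * ((1 - b / 2) * Real.log t) + cZero / (2 * s) * Real.log 2 := by
          rw [show cZero / (2 * s) * Real.log 2 = cZero / s * (Real.log 2 / 2) by ring, ← mul_add]
          gcongr
          linarith
        have h2 : Real.log 8 + cZero / (2 * s) * Real.log 2 + 1 ≤ ε / (2 * s) * Real.log t := by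
          have := mul_le_mul_of_nonneg_left hR2 (show 0 ≤ ε / (2 * s) by positivity)
          refine le_trans (le_of_eq ?_) this
          field_simp
        rw [← hbeq] at h2
        linarith
    _ = m / 4 := Real.exp_log (by positivity)

lemma half_exp_le_countM {u : ℝ} (h : Real.log 2 ≤ logCount u) :
    Real.exp (logCount u - Real.log 2) ≤ countM u := by
  rw [countM_eq, Real.exp_sub, Real.exp_log two_pos]
  have := Real.exp_le_exp.2 h
  rw [Real.exp_log two_pos] at this
  linarith

/-- If m < t^b, then L ≥ (1 - b/2) log t, and the product of the two counts is too large for m to be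
admissible. -/
lemma exists_le_of_mem_mZeroSet {sX sY s ε : ℝ} (hX : 0 < sX) (hY : 0 < sY)
    (hs : s = 2 / (sX⁻¹ + sY⁻¹)) (hε : 0 < ε) :
    ∃ C' : ℝ, 0 < C' ∧ ∀ t : ℝ, C' ≤ t → ∀ m ∈ mZeroSet sX sY t,
      t ^ ((2 * cZero - ε) / (2 * s + cZero)) ≤ m := by
  have hs0 : 0 < s := hs ▸ by positivity
  have hc := cZero_pos
  set b := (2 * cZero - ε) / (2 * s + cZero) with hb
  have hb2 : b < 2 := by rw [hb, div_lt_iff₀ (by positivity)]; linarith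
  have hbeq : cZero / s * (1 - b / 2) - b = ε / (2 * s) := by
    rw [hb]; field_simp; ring
  have hd : 0 < 1 - b / 2 := by linarith
  -- The first entry makes δ use up at most half of the surplus ε/(2s); the second keeps the slope
  -- `cZero - δ` at least `cZero / 2`.
  set δ := min (ε / 4 / (1 - b / 2)) (cZero / 2) with hδ
  have hδ0 : 0 < δ := by positivity
  have hδ1 : δ * (1 - b / 2) ≤ ε / 4 := by
    rw [← le_div_iff₀ hd]; exact min_le_left _ _
  have hδ2 : cZero / 2 ≤ cZero - δ := by
    have := min_le_right (ε / 4 / (1 - b / 2)) (cZero / 2)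
    rw [← hδ] at this; linarith
  obtain ⟨C, hC0, hC⟩ := exists_le_logCount hδ0
  have key : ∀ {L σ : ℝ}, 0 ≤ L → 0 < σ → (cZero - δ) * (L / (2 * σ)) - C ≤
      logCount (L ^ 2 / (4 * σ ^ 2)) := fun {L σ} hL hσ => by
    have := hC (L ^ 2 / (4 * σ ^ 2)) (by positivity)
    rwa [sqrt_sq_div hL hσ] at this
  -- The X and Y thresholds bring both log-counts above log 2, so that `half_exp_le_countM` applies;
  -- the last one absorbs the additive constants.
  set R := max 0 (max ((Real.log 2 + C) * (2 * sX) / (cZero / 2) / (1 - b / 2))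
    (max ((Real.log 2 + C) * (2 * sY) / (cZero / 2) / (1 - b / 2))
      ((4 * s / ε) * (2 * C + 2 * Real.log 2)))) with hR
  refine ⟨Real.exp R, Real.exp_pos _, fun t ht m hm => ?_⟩
  obtain ⟨hm1, hm⟩ := hm
  by_contra! hlt
  have ht0 : 0 < t := (Real.exp_pos _).trans_le ht
  have hlog : R ≤ Real.log t := (Real.le_log_iff_exp_le ht0).2 ht
  have hlt0 : 0 ≤ Real.log t := (le_max_left _ _).trans hlog
  have hR1 : _ ≤ Real.log t := ((le_max_left _ _).trans (le_max_right _ _)).trans hlog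
  have hR2 : _ ≤ Real.log t := (((le_max_left _ _).trans (le_max_right _ _)).trans
    (le_max_right _ _)).trans hlog
  have hR3 : _ ≤ Real.log t := (((le_max_right _ _).trans (le_max_right _ _)).trans
    (le_max_right _ _)).trans hlog
  have hm0 : (0 : ℝ) < m := by exact_mod_cast hm1
  set L := Real.log (t / √(m : ℝ)) with hL
  have hLeq : L = Real.log t - Real.log m / 2 := by
    rw [hL, Real.log_div (by positivity) (by positivity), Real.log_sqrt hm0.le]
  have hlm : Real.log m < b * Real.log t := by
    rw [← Real.log_rpow ht0]; exact Real.log_lt_log hm0 hlt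
  have hLge : (1 - b / 2) * Real.log t ≤ L := by rw [hLeq]; linarith
  have hL0 : 0 ≤ L := (mul_nonneg hd.le hlt0).trans hLge
  have two : ∀ {σ : ℝ}, 0 < σ → (Real.log 2 + C) * (2 * σ) / (cZero / 2) / (1 - b / 2) ≤
      Real.log t → Real.log 2 ≤ logCount (L ^ 2 / (4 * σ ^ 2)) := fun {σ} hσ h => by
    refine le_trans ?_ (key hL0 hσ)
    rw [div_le_iff₀ hd, div_le_iff₀ (by positivity)] at h
    have h3 : Real.log 2 + C ≤ cZero / 2 * (L / (2 * σ)) := by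
      rw [← mul_div_assoc, le_div_iff₀ (by positivity)]
      nlinarith
    have h4 : cZero / 2 * (L / (2 * σ)) ≤ (cZero - δ) * (L / (2 * σ)) :=
      mul_le_mul_of_nonneg_right hδ2 (by positivity)
    linarith
  have hbig : Real.exp ((cZero - δ) / s * L - 2 * C - 2 * Real.log 2) < m / 4 := by
    refine lt_of_le_of_lt ?_ hm
    refine le_trans ?_ (mul_le_mul (half_exp_le_countM (two hX hR1)) (half_exp_le_countM
      (two hY hR2)) (Real.exp_pos _).le countM_nonneg)
    rw [← Real.exp_add, Real.exp_le_exp]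
    have e : (cZero - δ) / s * L = (cZero - δ) * (L / (2 * sX)) + (cZero - δ) * (L / (2 * sY)) := by
      rw [hs]; field_simp
    linarith [key hL0 hX, key hL0 hY]
  have h5 := hbig.trans (show (m : ℝ) / 4 < m by linarith)
  rw [← Real.lt_log_iff_exp_lt hm0] at h5
  have h6 : (cZero - δ) / s * ((1 - b / 2) * Real.log t) ≤ (cZero - δ) / s * L :=
    mul_le_mul_of_nonneg_left hLge (div_nonneg (by linarith) hs0.le)
  have h7 : (cZero - δ) / s * ((1 - b / 2) * Real.log t) =
      (b + ε / (2 * s)) * Real.log t - δ * (1 - b / 2) / s * Real.log t := by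
    rw [← hbeq]; ring
  have h8 : δ * (1 - b / 2) / s * Real.log t ≤ ε / 4 / s * Real.log t := by gcongr
  have h9 : 2 * C + 2 * Real.log 2 ≤ ε / (4 * s) * Real.log t := by
    have := mul_le_mul_of_nonneg_left hR3 (show 0 ≤ ε / (4 * s) by positivity)
    refine le_trans (le_of_eq ?_) this
    field_simp
  have h10 : ε / (2 * s) * Real.log t - ε / 4 / s * Real.log t = ε / (4 * s) * Real.log t := by
    field_simp; ring
  linarith

lemma mZeroSet_nonempty {sX sY : ℝ} (hX : 0 < sX) (hY : 0 < sY) :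
    ∃ C' : ℝ, 0 < C' ∧ ∀ t : ℝ, C' ≤ t → (mZeroSet sX sY t).Nonempty := by
  have hs : 0 < 2 / (sX⁻¹ + sY⁻¹) := by positivity
  obtain ⟨C, hC, h⟩ := exists_mem_mZeroSet hX hY rfl hs (by linarith)
  exact ⟨C, hC, fun t ht => let ⟨m, hm, _⟩ := h t ht; ⟨m, hm⟩⟩

lemma mZero_growth {sX sY s ε : ℝ} (hX : 0 < sX) (hY : 0 < sY)
    (hs : s = 2 / (sX⁻¹ + sY⁻¹)) (hε : 0 < ε) (hε' : ε < 4 * s) :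
    ∃ C' : ℝ, 0 < C' ∧ ∀ t : ℝ, C' ≤ t →
      t ^ ((2 * cZero - ε) / (2 * s + cZero)) ≤ (mZero sX sY t : ℝ) ∧
        (mZero sX sY t : ℝ) ≤ t ^ ((2 * cZero + ε) / (2 * s + cZero)) := by
  obtain ⟨C₁, h₁, H₁⟩ := exists_mem_mZeroSet hX hY hs hε hε'
  obtain ⟨C₂, -, H₂⟩ := exists_le_of_mem_mZeroSet hX hY hs hε
  refine ⟨max C₁ C₂, lt_max_of_lt_left h₁, fun t ht => ?_⟩
  obtain ⟨m, hm, hmt⟩ := H₁ t ((le_max_left _ _).trans ht)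
  refine ⟨H₂ t ((le_max_right _ _).trans ht) _ (Nat.sInf_mem ⟨m, hm⟩), le_trans ?_ hmt⟩
  exact_mod_cast Nat.sInf_le hm

/-! ### A self-normalised sign-flip test on the line -/

/-- The rejection region of the self-normalised sum test. -/
def selfNormRegion (α : ℝ) (N : ℕ) : Set (Fin N → ℝ) :=
  {u | ∑ i, u i ^ 2 < α * (∑ i, u i) ^ 2}

lemma measurableSet_selfNormRegion (α : ℝ) (N : ℕ) : MeasurableSet (selfNormRegion α N) :=
  measurableSet_lt (by fun_prop) (by fun_prop)

/-- Signs as real numbers. -/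
def signVal (b : Bool) : ℝ := if b then 1 else -1

lemma signVal_sq (b : Bool) : signVal b ^ 2 = 1 := by cases b <;> simp [signVal]

/-- Orthogonality of random signs: the cross terms cancel between the two values of each sign. -/
lemma sum_signVal_mul_sq (N : ℕ) (u : Fin N → ℝ) :
    ∑ ε : Fin N → Bool, (∑ i, signVal (ε i) * u i) ^ 2 = 2 ^ N * ∑ i, u i ^ 2 := by
  induction N with
  | zero => simp
  | succ N ih =>
    rw [← (Fin.consEquiv fun _ => Bool).sum_comp, Fintype.sum_prod_type]
    simp only [Fin.consEquiv_apply, Fin.sum_univ_succ, Fin.cons_zero, Fin.cons_succ,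
      Fintype.sum_bool]
    rw [← Finset.sum_add_distrib]
    have h : ∀ ε : Fin N → Bool,
        (signVal true * u 0 + ∑ i, signVal (ε i) * u i.succ) ^ 2 +
        (signVal false * u 0 + ∑ i, signVal (ε i) * u i.succ) ^ 2 =
        2 * u 0 ^ 2 + 2 * (∑ i, signVal (ε i) * u i.succ) ^ 2 := fun ε => by
      simp [signVal]; ring
    simp_rw [h]
    rw [Finset.sum_add_distrib, ← Finset.mul_sum, ← Finset.mul_sum, ih fun i => u i.succ]
    simp only [Finset.sum_const, Finset.card_univ, Fintype.card_fun, Fintype.card_bool,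
      Fintype.card_fin, nsmul_eq_mul, Nat.cast_pow, Nat.cast_ofNat]
    ring

/-- Markov's inequality for uniform random signs with the sample held fixed; Σ u_i² does not change
under flips. -/
lemma card_flips_mem_le {α : ℝ} (hα : 0 < α) (N : ℕ) (u : Fin N → ℝ) :
    ∑ ε : Fin N → Bool,
      (selfNormRegion α N).indicator (1 : (Fin N → ℝ) → ℝ) (fun i => signVal (ε i) * u i) ≤
      2 ^ N * α := by
  have hsq : ∀ ε : Fin N → Bool, ∑ i, (signVal (ε i) * u i) ^ 2 = ∑ i, u i ^ 2 := fun ε => by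
    simp_rw [mul_pow, signVal_sq, one_mul]
  set V := ∑ i, u i ^ 2
  have hV : 0 ≤ V := Finset.sum_nonneg fun _ _ => sq_nonneg _
  -- The zero sample is never rejected, because the inequality defining the region is strict.
  rcases hV.eq_or_lt with h0 | hpos
  · have hu : ∀ i, u i = 0 := fun i => by
      have := (Finset.sum_eq_zero_iff_of_nonneg fun i _ => sq_nonneg (u i)).1 h0.symm i
        (Finset.mem_univ i)
      exact pow_eq_zero_iff two_ne_zero |>.1 this
    refine le_trans (le_of_eq ?_) (by positivity : (0 : ℝ) ≤ _)
    refine Finset.sum_eq_zero fun ε _ => Set.indicator_of_notMem ?_ _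
    simp [selfNormRegion, hu]
  · have hb : ∀ ε : Fin N → Bool,
        (selfNormRegion α N).indicator (1 : (Fin N → ℝ) → ℝ) (fun i => signVal (ε i) * u i) ≤
        α / V * (∑ i, signVal (ε i) * u i) ^ 2 := fun ε => by
      by_cases h : (fun i => signVal (ε i) * u i) ∈ selfNormRegion α N
      · rw [Set.indicator_of_mem h, Pi.one_apply]
        have h' : V < α * (∑ i, signVal (ε i) * u i) ^ 2 := by
          have := h
          rw [selfNormRegion, Set.mem_ofPred_eq, hsq] at this
          exact this
        rw [div_mul_eq_mul_div, le_div_iff₀ hpos]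
        linarith
      · rw [Set.indicator_of_notMem h]; positivity
    refine (Finset.sum_le_sum fun ε _ => hb ε).trans (le_of_eq ?_)
    rw [← Finset.mul_sum, sum_signVal_mul_sq]
    field_simp
    rfl

lemma map_signVal_mul {κ : Measure ℝ} (hκ : κ.map (fun x => -x) = κ) (b : Bool) :
    MeasurePreserving (fun x => signVal b * x) κ κ := by
  cases b
  · exact ⟨by fun_prop, by simpa [signVal] using hκ⟩
  · have : (fun x : ℝ => signVal true * x) = id := by ext; simp [signVal]
    rw [this]
    exact MeasurePreserving.id κ

/-- By symmetry the rejection probability equals its average over all sign flips, which is bounded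
sample by sample. No moment of `κ` is needed. -/
lemma measure_selfNormRegion_le {κ : Measure ℝ} [IsProbabilityMeasure κ]
    (hκ : κ.map (fun x => -x) = κ) {α : ℝ} (hα : 0 < α) (N : ℕ) :
    Measure.pi (fun _ : Fin N => κ) (selfNormRegion α N) ≤ ENNReal.ofReal α := by
  set Q := Measure.pi fun _ : Fin N => κ with hQ
  have hm := measurableSet_selfNormRegion α N
  have hpres : ∀ ε : Fin N → Bool, MeasurePreserving (fun u i => signVal (ε i) * u i) Q Q :=
    fun ε => measurePreserving_pi _ _ fun i => map_signVal_mul hκ (ε i)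
  have hint : ∀ ε : Fin N → Bool, Q.real (selfNormRegion α N) =
      ∫ u, (selfNormRegion α N).indicator (1 : (Fin N → ℝ) → ℝ)
        (fun i => signVal (ε i) * u i) ∂Q := fun ε => by
    rw [← integral_indicator_one hm]
    conv_lhs => rw [← (hpres ε).map_eq]
    rw [integral_map (hpres ε).measurable.aemeasurable]
    exact (measurable_one.indicator hm).aestronglyMeasurable
  have hI : ∀ ε : Fin N → Bool, Integrable (fun u => (selfNormRegion α N).indicator
      (1 : (Fin N → ℝ) → ℝ) (fun i => signVal (ε i) * u i)) Q := fun ε =>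
    (hpres ε).integrable_comp_of_integrable ((integrable_const (1 : ℝ)).indicator hm)
  have hsum : (2 : ℝ) ^ N * Q.real (selfNormRegion α N) ≤ 2 ^ N * α := by
    calc _ = ∑ ε : Fin N → Bool, Q.real (selfNormRegion α N) := by simp
      _ = ∫ u, ∑ ε : Fin N → Bool, (selfNormRegion α N).indicator (1 : (Fin N → ℝ) → ℝ)
        (fun i => signVal (ε i) * u i) ∂Q := by
          rw [integral_finsetSum _ fun ε _ => hI ε]
          exact Finset.sum_congr rfl fun ε _ => hint ε
      _ ≤ ∫ _, 2 ^ N * α ∂Q := integral_mono (integrable_finsetSum _ fun ε _ => hI ε)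
          (integrable_const _) fun u => card_flips_mem_le hα N u
      _ = _ := by simp
  have := le_of_mul_le_mul_left hsum (by positivity)
  rw [measureReal_def] at this
  exact (ENNReal.le_ofReal_iff_toReal_le (measure_ne_top _ _) hα.le).2 this

/-! ### Moments of i.i.d. sums and the power of the self-normalised test. -/

section Moments

variable {κ : Measure ℝ} [IsProbabilityMeasure κ]

lemma integral_sum_pi {E : Type*} [MeasurableSpace E] {ν : Measure E} [IsProbabilityMeasure ν]
    {N : ℕ} {g : E → ℝ} (hg : Integrable g ν) :
    Integrable (fun u : Fin N → E => ∑ i, g (u i)) (Measure.pi fun _ : Fin N => ν) ∧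
    ∫ u, ∑ i, g (u i) ∂(Measure.pi fun _ : Fin N => ν) = N * ∫ x, g x ∂ν := by
  have hp := fun i : Fin N => measurePreserving_eval (fun _ : Fin N => ν) i
  have hI : ∀ i : Fin N, Integrable (fun u : Fin N → E => g (u i))
      (Measure.pi fun _ : Fin N => ν) := fun i => (hp i).integrable_comp_of_integrable hg
  refine ⟨integrable_finsetSum _ fun i _ => hI i, ?_⟩
  rw [integral_finsetSum _ fun i _ => hI i]
  have : ∀ i : Fin N, ∫ u, g (u i) ∂(Measure.pi fun _ : Fin N => ν) = ∫ x, g x ∂ν := fun i => by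
    have h := integral_map (hp i).measurable.aemeasurable (f := g)
      ((hp i).map_eq.symm ▸ hg.aestronglyMeasurable)
    rw [(hp i).map_eq] at h
    exact h.symm
  simp [this]

lemma variance_sum_pi_le {E : Type*} [MeasurableSpace E] {ν : Measure E} [IsProbabilityMeasure ν]
    {N : ℕ} {g : E → ℝ} (hg : MemLp g 2 ν) {V : ℝ} (hV : ∫ x, g x ^ 2 ∂ν ≤ V) :
    MemLp (fun u : Fin N → E => ∑ i, g (u i)) 2 (Measure.pi fun _ : Fin N => ν) ∧
    Var[fun u : Fin N → E => ∑ i, g (u i); Measure.pi fun _ : Fin N => ν] ≤ N * V := by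
  have hp := fun i : Fin N => measurePreserving_eval (fun _ : Fin N => ν) i
  constructor
  · exact memLp_finsetSum _ fun i _ => hg.comp_measurePreserving (hp i)
  · have h := variance_sum_pi (ι := Fin N) (μ := fun _ => ν) (X := fun _ => g) fun _ => hg
    have e : (∑ i : Fin N, fun ω : Fin N → E => g (ω i)) = fun u => ∑ i, g (u i) := by
      ext u; simp
    rw [e] at h
    rw [h, Finset.sum_const, Finset.card_univ, Fintype.card_fin, nsmul_eq_mul]
    gcongr
    exact (variance_le_expectation_sq hg.aestronglyMeasurable).trans hV

/-- Chebyshev's inequality for a sum of i.i.d. variables, in the form used for lower deviations. -/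
lemma measure_sum_pi_far_le {E : Type*} [MeasurableSpace E] {ν : Measure E}
    [IsProbabilityMeasure ν] {N : ℕ} {g : E → ℝ} (hg : MemLp g 2 ν) {V c : ℝ}
    (hV : ∫ x, g x ^ 2 ∂ν ≤ V) (hc : 0 < c) :
    Measure.pi (fun _ : Fin N => ν) {u | c ≤ |∑ i, g (u i) - N * ∫ x, g x ∂ν|} ≤
      ENNReal.ofReal (N * V / c ^ 2) := by
  obtain ⟨h1, h2⟩ := variance_sum_pi_le (N := N) hg hV
  have h := meas_ge_le_variance_div_sq h1 hc
  rw [(integral_sum_pi (N := N) (hg.integrable one_le_two)).2] at h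
  refine h.trans (ENNReal.ofReal_le_ofReal ?_)
  gcongr

/-- Markov's inequality in real form. -/
lemma measure_ge_le_ofReal {E : Type*} [MeasurableSpace E] {Q : Measure E} {g : E → ℝ}
    (hg : Integrable g Q) (h0 : ∀ x, 0 ≤ g x) {V c : ℝ} (hV : ∫ x, g x ∂Q ≤ V) (hc : 0 < c) :
    Q {u | c ≤ g u} ≤ ENNReal.ofReal (V / c) := by
  have h := mul_meas_ge_le_lintegral₀ (μ := Q) (f := fun x => ENNReal.ofReal (g x))
    hg.aestronglyMeasurable.aemeasurable.ennreal_ofReal (ENNReal.ofReal c)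
  rw [← ofReal_integral_eq_lintegral_ofReal hg (Eventually.of_forall h0)] at h
  have e : {x | ENNReal.ofReal c ≤ ENNReal.ofReal (g x)} = {u | c ≤ g u} := by
    ext x; exact ENNReal.ofReal_le_ofReal_iff (h0 x)
  rw [e] at h
  rw [ENNReal.ofReal_div_of_pos hc, ENNReal.le_div_iff_mul_le (Or.inl (by simpa using hc))
    (Or.inl ENNReal.ofReal_ne_top), mul_comm]
  exact h.trans (ENNReal.ofReal_le_ofReal hV)

/-- Rejection is forced when |Σ u_i| > N|m|/2 and Σ u_i² < α(N|m|/2)². Chebyshev and Markov bound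
the failures by 4V/(Nm²) and 4V/(αNm²), whence the 8. -/
lemma measure_compl_selfNormRegion_le {α β V : ℝ} (hα : 0 < α) (hα1 : α < 1) {N : ℕ}
    (h2 : MemLp (fun x => x) 2 κ) (hV : ∫ x, x ^ 2 ∂κ ≤ V) (hm : ∫ x, x ∂κ ≠ 0) (hN : 0 < N)
    (hV0 : 0 ≤ V) (h : 8 * V ≤ α * β * (N * (∫ x, x ∂κ) ^ 2)) :
    Measure.pi (fun _ : Fin N => κ) (selfNormRegion α N)ᶜ ≤ ENNReal.ofReal β := by
  set m := ∫ x, x ∂κ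
  have hN' : (0 : ℝ) < N := by exact_mod_cast hN
  have hm2 : 0 < m ^ 2 := by positivity
  have hma : 0 < |m| := abs_pos.2 hm
  have hI2 : Integrable (fun x : ℝ => x ^ 2) κ := h2.integrable_sq
  obtain ⟨hI, he⟩ := integral_sum_pi (N := N) hI2
  have B1 := measure_sum_pi_far_le (N := N) h2 hV (show 0 < N * |m| / 2 by positivity)
  have B2 := measure_ge_le_ofReal (c := α * (N * |m| / 2) ^ 2) (V := N * V) hI
    (fun u => Finset.sum_nonneg fun i _ => sq_nonneg _)
    (he.trans_le (mul_le_mul_of_nonneg_left hV hN'.le)) (by positivity)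
  have hsub : (selfNormRegion α N)ᶜ ⊆ {u | N * |m| / 2 ≤ |∑ i, u i - N * m|} ∪
      {u | α * (N * |m| / 2) ^ 2 ≤ ∑ i, u i ^ 2} := by
    intro u hu
    rw [selfNormRegion, Set.mem_compl_iff, Set.mem_ofPred_eq, not_lt] at hu
    by_contra hcon
    simp only [Set.mem_union, Set.mem_ofPred_eq, not_or, not_le] at hcon
    obtain ⟨h3, h4⟩ := hcon
    have h5 : N * |m| / 2 ≤ |∑ i, u i| := by
      have h6 := abs_sub_abs_le_abs_sub (N * m) (∑ i, u i)
      rw [abs_mul, abs_of_pos hN', abs_sub_comm] at h6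
      linarith
    have h7 : (N * |m| / 2) ^ 2 ≤ (∑ i, u i) ^ 2 := by
      rw [← sq_abs (∑ i, u i)]; gcongr
    nlinarith
  refine (measure_mono hsub).trans ((measure_union_le _ _).trans ((add_le_add B1 B2).trans ?_))
  rw [← ENNReal.ofReal_add (by positivity) (by positivity)]
  refine ENNReal.ofReal_le_ofReal ?_
  have e1 : N * V / (N * |m| / 2) ^ 2 = 4 * V / (N * m ^ 2) := by
    rw [div_pow, mul_pow, sq_abs]; field_simp; norm_num
  have e2 : N * V / (α * (N * |m| / 2) ^ 2) = 4 * V / (α * (N * m ^ 2)) := by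
    rw [div_pow, mul_pow, sq_abs]; field_simp; norm_num
  have e3 : 4 * V / (N * m ^ 2) ≤ 4 * V / (α * (N * m ^ 2)) := by
    exact div_le_div_of_nonneg_left (by positivity) (by positivity)
      (mul_le_of_le_one_left (by positivity) hα1.le)
  rw [e1, e2]
  refine (add_le_add_left e3 _).trans ?_
  rw [← add_div, div_le_iff₀ (by positivity)]
  linarith

end Moments

/-! ### The test for vector-valued observations -/

section Vector

variable {ι : Type*} [Fintype ι]

/-- The rejection region: the second sample provides a direction onto which the first sample is
projected, and the self-normalised test is applied to the projections. -/
def vectorRegion (ι : Type*) [Fintype ι] (α : ℝ) (N : ℕ) :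
    Set ((Fin N → ι → ℝ) × (Fin N → ι → ℝ)) :=
  {p | (fun i => (∑ k, p.2 k) ⬝ᵥ p.1 i) ∈ selfNormRegion α N}

lemma measurable_dotProduct_right (w : ι → ℝ) : Measurable fun z : ι → ℝ => w ⬝ᵥ z := by
  unfold dotProduct; fun_prop

lemma measurableSet_vectorRegion (α : ℝ) (N : ℕ) : MeasurableSet (vectorRegion ι α N) := by
  refine measurableSet_preimage (f := fun p : (Fin N → ι → ℝ) × (Fin N → ι → ℝ) =>
    (fun i => (∑ k, p.2 k) ⬝ᵥ p.1 i)) ?_ (measurableSet_selfNormRegion α N)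
  unfold dotProduct
  simp only [Finset.sum_apply]
  fun_prop

variable {ν : Measure (ι → ℝ)} {B : ℝ}

lemma memLp_dotProduct (hL : ∀ j, MemLp (fun z : ι → ℝ => z j) 2 ν) (w : ι → ℝ) :
    MemLp (fun z => w ⬝ᵥ z) 2 ν :=
  memLp_finsetSum _ fun j _ => (hL j).const_mul (w j)

lemma integral_coord_sq_le (hB : ∀ w : ι → ℝ, ∫ z, (w ⬝ᵥ z) ^ 2 ∂ν ≤ B * (w ⬝ᵥ w)) (j : ι) :
    ∫ z, z j ^ 2 ∂ν ≤ B := by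
  classical
  simpa using hB (Pi.single j 1)

variable [IsProbabilityMeasure ν]

instance isProbabilityMeasure_map_dotProduct (w : ι → ℝ) :
    IsProbabilityMeasure (ν.map fun z => w ⬝ᵥ z) :=
  Measure.isProbabilityMeasure_map (measurable_dotProduct_right w).aemeasurable

lemma measurePreserving_dotProduct (N : ℕ) (w : ι → ℝ) :
    MeasurePreserving (fun (z : Fin N → ι → ℝ) i => w ⬝ᵥ z i) (Measure.pi fun _ : Fin N => ν)
      (Measure.pi fun _ : Fin N => ν.map fun z => w ⬝ᵥ z) :=
  measurePreserving_pi _ _ fun _ => (measurable_dotProduct_right w).measurePreserving ν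

/-- Given the second sample the direction is fixed and the projections are i.i.d. symmetric, so the
level holds on every section. -/
lemma measure_vectorRegion_le (hν : ν.map (fun z => -z) = ν) {α : ℝ} (hα : 0 < α) (N : ℕ) :
    ((Measure.pi fun _ : Fin N => ν).prod (Measure.pi fun _ : Fin N => ν))
      (vectorRegion ι α N) ≤ ENNReal.ofReal α := by
  rw [Measure.prod_apply_symm (measurableSet_vectorRegion α N)]
  refine (lintegral_mono (g := fun _ => ENNReal.ofReal α) fun w => ?_).trans (by simp)
  have hp := measurePreserving_dotProduct (ν := ν) N (∑ k, w k)
  have h := hp.measure_preimage (measurableSet_selfNormRegion α N).nullMeasurableSet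
  refine (Eq.trans_le h (measure_selfNormRegion_le ?_ hα N))
  rw [Measure.map_map measurable_neg (measurable_dotProduct_right _)]
  conv_rhs => rw [← hν]
  rw [Measure.map_map (measurable_dotProduct_right _) measurable_neg]
  congr 1
  ext z
  simp

variable {δ : ι → ℝ}

lemma integral_dotProduct (hL : ∀ j, MemLp (fun z : ι → ℝ => z j) 2 ν)
    (hδ : ∀ j, ∫ z, z j ∂ν = δ j) (w : ι → ℝ) : ∫ z, w ⬝ᵥ z ∂ν = w ⬝ᵥ δ := by
  unfold dotProduct
  rw [integral_finsetSum _ fun j _ => ((hL j).integrable one_le_two).const_mul (w j)]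
  simp_rw [integral_const_mul, hδ]

/-- Variances of the coordinates add up to the first term; the squared mean gives the second. -/
lemma integral_norm_sum_sq_le (hL : ∀ j, MemLp (fun z : ι → ℝ => z j) 2 ν)
    (hδ : ∀ j, ∫ z, z j ∂ν = δ j)
    (hB : ∀ w : ι → ℝ, ∫ z, (w ⬝ᵥ z) ^ 2 ∂ν ≤ B * (w ⬝ᵥ w)) (N : ℕ) :
    Integrable (fun w : Fin N → ι → ℝ => (∑ k, w k) ⬝ᵥ ∑ k, w k)
      (Measure.pi fun _ : Fin N => ν) ∧
    ∫ w, (∑ k, w k) ⬝ᵥ ∑ k, w k ∂(Measure.pi fun _ : Fin N => ν) ≤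
      N * B * Fintype.card ι + N ^ 2 * (δ ⬝ᵥ δ) := by
  have hv := fun j => variance_sum_pi_le (N := N) (hL j) (integral_coord_sq_le hB j)
  have hI : ∀ j ∈ Finset.univ, Integrable (fun w : Fin N → ι → ℝ => (∑ k, w k j) * ∑ k, w k j)
      (Measure.pi fun _ : Fin N => ν) := fun j _ => by
    simpa only [sq] using (hv j).1.integrable_sq
  simp only [dotProduct, Finset.sum_apply]
  refine ⟨integrable_finsetSum _ hI, ?_⟩
  rw [integral_finsetSum _ hI]
  have hj : ∀ j, ∫ w : Fin N → ι → ℝ, (∑ k, w k j) * ∑ k, w k j ∂(Measure.pi fun _ : Fin N => ν)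
      ≤ N * B + N ^ 2 * (δ j * δ j) := fun j => by
    have h := variance_eq_sub (hv j).1
    rw [(integral_sum_pi (N := N) ((hL j).integrable one_le_two)).2, hδ] at h
    have h2 := (hv j).2
    simp only [Pi.pow_apply] at h
    simp only [← sq]
    linarith [mul_pow (N : ℝ) (δ j) 2]
  refine (Finset.sum_le_sum fun j _ => hj j).trans (le_of_eq ?_)
  rw [Finset.sum_add_distrib, Finset.mul_sum]
  simp
  ring

/-- Chebyshev bound on the type II error conditionally on a favourable direction. -/
lemma measure_section_compl_le (hL : ∀ j, MemLp (fun z : ι → ℝ => z j) 2 ν)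
    (hδ : ∀ j, ∫ z, z j ∂ν = δ j)
    (hB : ∀ w : ι → ℝ, ∫ z, (w ⬝ᵥ z) ^ 2 ∂ν ≤ B * (w ⬝ᵥ w)) (hB0 : 0 ≤ B)
    {α β : ℝ} (hα : 0 < α) (hα1 : α < 1) {N : ℕ} (hN : 0 < N) (w : ι → ℝ) (hw : w ⬝ᵥ δ ≠ 0)
    (h : 8 * (B * (w ⬝ᵥ w)) ≤ α * β * (N * (w ⬝ᵥ δ) ^ 2)) :
    Measure.pi (fun _ : Fin N => ν) {z | (fun i => w ⬝ᵥ z i) ∈ (selfNormRegion α N)ᶜ} ≤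
      ENNReal.ofReal β := by
  have hmw := measurable_dotProduct_right w
  have hp := measurePreserving_dotProduct (ν := ν) N w
  have hpre := hp.measure_preimage (measurableSet_selfNormRegion α N).compl.nullMeasurableSet
  have hmean : ∫ x, x ∂(ν.map fun z => w ⬝ᵥ z) = w ⬝ᵥ δ := by
    rw [integral_map hmw.aemeasurable (by fun_prop)]
    exact integral_dotProduct hL hδ w
  refine Eq.trans_le hpre (measure_compl_selfNormRegion_le (V := B * (w ⬝ᵥ w)) hα hα1 ?_ ?_ ?_ hN
    (mul_nonneg hB0 (Finset.sum_nonneg fun i _ => mul_self_nonneg _)) ?_)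
  · exact (memLp_map_measure_iff (by fun_prop) hmw.aemeasurable).2 (memLp_dotProduct hL w)
  · rw [integral_map hmw.aemeasurable (by fun_prop)]
    exact hB w
  · rwa [hmean]
  · rwa [hmean]

/-- The fluctuation of w·δ is bounded free of the dimension, which enters only through |w|²; this is
why it costs √M and not M. The error budget is β/4 for w·δ, β/2 for |w|² and β/4 for the test given
a good direction. -/
lemma measure_vectorRegion_compl_le (hL : ∀ j, MemLp (fun z : ι → ℝ => z j) 2 ν)
    (hδ : ∀ j, ∫ z, z j ∂ν = δ j)
    (hB : ∀ w : ι → ℝ, ∫ z, (w ⬝ᵥ z) ^ 2 ∂ν ≤ B * (w ⬝ᵥ w)) (hB0 : 0 < B)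
    {α β : ℝ} (hα : 0 < α) (hα1 : α < 1) (hβ : 0 < β) {N : ℕ} {M K : ℝ} (hM : 1 ≤ M)
    (hcard : (Fintype.card ι : ℝ) ≤ M) (hK1 : 1 ≤ K) (hK2 : 16 * B / β ≤ K)
    (hK3 : 512 * B ^ 2 / (α * β ^ 2) ≤ K) (hK4 : 512 * B / (α * β ^ 2) ≤ K)
    (hsep : K * √M ≤ N * (δ ⬝ᵥ δ)) :
    ((Measure.pi fun _ : Fin N => ν).prod (Measure.pi fun _ : Fin N => ν))
      (vectorRegion ι α N)ᶜ ≤ ENNReal.ofReal β := by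
  set Q := Measure.pi fun _ : Fin N => ν with hQ
  set Δ := δ ⬝ᵥ δ with hΔ
  have hM0 : 0 < √M := by positivity
  have hND : 0 < N * Δ := (mul_pos (by linarith) hM0).trans_le hsep
  have hΔ0 : 0 < Δ := pos_of_mul_pos_right hND N.cast_nonneg
  have hN0 : (0 : ℝ) < N := pos_of_mul_pos_left hND hΔ0.le
  have hM1 : 1 ≤ √M := Real.one_le_sqrt.2 hM
  have hKN : K ≤ N * Δ := by nlinarith
  have hKM : K * M ≤ (N * Δ) ^ 2 := by
    have h1 : (K * √M) ^ 2 ≤ (N * Δ) ^ 2 := by gcongr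
    rw [mul_pow, Real.sq_sqrt (by linarith)] at h1
    nlinarith
  -- The solution of 8Bτ = α(β/4)·N(NΔ/2)²: the largest |w|² that `measure_section_compl_le`
  -- tolerates at error β/4 when w·δ = NΔ/2.
  set τ := α * β * N ^ 3 * Δ ^ 2 / (128 * B) with hτ
  have hτ0 : 0 < τ := by positivity
  set b₁ : Set (Fin N → ι → ℝ) := {w | N * Δ / 2 ≤ |∑ k, δ ⬝ᵥ w k - N * ∫ z, δ ⬝ᵥ z ∂ν|} with hb₁
  set b₂ : Set (Fin N → ι → ℝ) := {w | τ ≤ (∑ k, w k) ⬝ᵥ ∑ k, w k} with hb₂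
  have B1 : Q b₁ ≤ ENNReal.ofReal (β / 4) := by
    refine (measure_sum_pi_far_le (memLp_dotProduct hL δ) (hB δ) (by positivity)).trans
      (ENNReal.ofReal_le_ofReal ?_)
    rw [← hΔ, div_le_iff₀ (by positivity)]
    rw [div_le_iff₀ hβ] at hK2
    have : 16 * B ≤ N * Δ * β := hK2.trans (by gcongr)
    have := mul_le_mul_of_nonneg_left this hND.le
    linarith
  obtain ⟨hI, hE⟩ := integral_norm_sum_sq_le hL hδ hB N
  have B2 : Q b₂ ≤ ENNReal.ofReal (β / 2) := by
    refine (measure_ge_le_ofReal hI (fun x => Finset.sum_nonneg fun i _ => mul_self_nonneg _)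
      (hE.trans (b := _) (add_le_add_left (mul_le_mul_of_nonneg_left hcard
        (by positivity)) _)) hτ0).trans (ENNReal.ofReal_le_ofReal ?_)
    rw [← hΔ, div_le_iff₀ hτ0, hτ, ← mul_div_assoc, le_div_iff₀ (by positivity)]
    rw [div_le_iff₀ (by positivity)] at hK3 hK4
    have h3 : 512 * B ^ 2 * M ≤ (N * Δ) ^ 2 * (α * β ^ 2) :=
      calc _ ≤ K * (α * β ^ 2) * M := by gcongr
        _ = K * M * (α * β ^ 2) := by ring
        _ ≤ _ := by gcongr
    have h4 : 512 * B ≤ N * Δ * (α * β ^ 2) := hK4.trans (by gcongr)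
    have h3' := mul_le_mul_of_nonneg_left h3 hN0.le
    have h4' := mul_le_mul_of_nonneg_left h4 (show 0 ≤ N * (N * Δ) by positivity)
    nlinarith
  have hm1 : MeasurableSet b₁ := by
    rw [hb₁]; unfold dotProduct
    exact measurableSet_le measurable_const (by fun_prop)
  have hm2 : MeasurableSet b₂ := by
    rw [hb₂]; unfold dotProduct; simp only [Finset.sum_apply]
    exact measurableSet_le measurable_const (by fun_prop)
  rw [Measure.prod_apply_symm (measurableSet_vectorRegion α N).compl]
  have hpt : ∀ w, Q ((fun z => (z, w)) ⁻¹' (vectorRegion ι α N)ᶜ) ≤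
      ENNReal.ofReal (β / 4) + (b₁ ∪ b₂).indicator 1 w := fun w => by
    by_cases hw : w ∈ b₁ ∪ b₂
    · rw [Set.indicator_of_mem hw, Pi.one_apply]
      exact prob_le_one.trans le_add_self
    · refine le_add_right ?_
      simp only [hb₁, hb₂, Set.mem_union, Set.mem_ofPred_eq, not_or, not_le] at hw
      obtain ⟨g1, g2⟩ := hw
      rw [integral_dotProduct hL hδ δ, ← hΔ] at g1
      have hdot : (∑ k, w k) ⬝ᵥ δ = ∑ k, δ ⬝ᵥ w k := by
        rw [dotProduct_comm, dotProduct_sum]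
      have g3 : N * Δ / 2 ≤ (∑ k, w k) ⬝ᵥ δ := by
        rw [hdot]; linarith [(abs_lt.1 g1).1]
      refine measure_section_compl_le hL hδ hB hB0.le hα hα1 (by exact_mod_cast hN0) (∑ k, w k)
        (by linarith) ?_
      have g4 : (N * Δ / 2) ^ 2 ≤ ((∑ k, w k) ⬝ᵥ δ) ^ 2 := by gcongr
      calc _ ≤ 8 * (B * τ) := by gcongr
        _ = α * (β / 4) * (N * (N * Δ / 2) ^ 2) := by rw [hτ]; field_simp; ring
        _ ≤ _ := by gcongr
  refine (lintegral_mono hpt).trans ?_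
  rw [lintegral_add_left measurable_const, lintegral_indicator_one (hm1.union hm2)]
  simp only [lintegral_const, measure_univ, mul_one]
  refine (add_le_add_right ((measure_union_le _ _).trans (add_le_add B1 B2)) _).trans (le_of_eq ?_)
  rw [← ENNReal.ofReal_add (by positivity) (by positivity),
    ← ENNReal.ofReal_add (by positivity) (by positivity)]
  congr 1; ring

end Vector

/-! ### Splitting the sample into blocks -/

section Blocks

variable {Ω E : Type*} [MeasurableSpace Ω] [MeasurableSpace E]

lemma measurePreserving_precomp {n : ℕ} {I : Type*} [Fintype I] (P : Measure Ω)
    [IsProbabilityMeasure P] {e : I → Fin n} (he : Function.Injective e) :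
    MeasurePreserving (fun (z : Fin n → Ω) i => z (e i)) (Measure.pi fun _ => P)
      (Measure.pi fun _ => P) := by
  refine ⟨by fun_prop, ?_⟩
  have h := (iIndepFun_pi (μ := fun _ : Fin n => P) (X := fun _ x => x)
    fun _ => aemeasurable_id).precomp he
  have h2 := (iIndepFun_iff_map_fun_eq_pi_map
    (fun i => (measurable_pi_apply (e i)).aemeasurable)).1 h
  rw [h2]
  congr 1
  ext i : 1
  exact (measurePreserving_eval (fun _ : Fin n => P) (e i)).map_eq

lemma measurePreserving_pairBlocks {n : ℕ} {I : Type*} [Fintype I] (P : Measure Ω)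
    [IsProbabilityMeasure P] {e : I ⊕ I → Fin n} (he : Function.Injective e)
    {g : Ω × Ω → E} (hg : Measurable g) :
    MeasurePreserving (fun (z : Fin n → Ω) i => g (z (e (.inl i)), z (e (.inr i))))
      (Measure.pi fun _ => P) (Measure.pi fun _ => (P.prod P).map g) := by
  have h1 := measurePreserving_precomp P he
  have h2 := measurePreserving_sumPiEquivProdPi (fun _ : I ⊕ I => P)
  have h3 := (measurePreserving_arrowProdEquivProdArrow Ω Ω I (fun _ => P) (fun _ => P)).symm
  have : IsProbabilityMeasure ((P.prod P).map g) :=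
    Measure.isProbabilityMeasure_map hg.aemeasurable
  have h4 := measurePreserving_pi (fun _ : I => P.prod P) (fun _ => (P.prod P).map g)
    fun _ => hg.measurePreserving _
  exact h4.comp (h3.comp (h2.comp h1))

/-- Each of the two samples of N kernel vectors consumes N pairs of observations. -/
lemma exists_injective_blocks {n N : ℕ} (h : 4 * N ≤ n) :
    ∃ e : (Fin N ⊕ Fin N) ⊕ (Fin N ⊕ Fin N) → Fin n, Function.Injective e := by
  have : Fintype.card ((Fin N ⊕ Fin N) ⊕ (Fin N ⊕ Fin N)) ≤ Fintype.card (Fin n) := by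
    simp; lia
  exact (Function.Embedding.nonempty_of_card_le this).elim fun e => ⟨e, e.injective⟩

lemma exists_splitMap {n N : ℕ} (h : 4 * N ≤ n) {g : Ω × Ω → E} (hg : Measurable g) :
    ∃ Φ : (Fin n → Ω) → (Fin N → E) × (Fin N → E), Measurable Φ ∧
      ∀ P : Measure Ω, IsProbabilityMeasure P → MeasurePreserving Φ (Measure.pi fun _ => P)
        ((Measure.pi fun _ => (P.prod P).map g).prod (Measure.pi fun _ => (P.prod P).map g)) := by
  obtain ⟨e, he⟩ := exists_injective_blocks h
  refine ⟨fun z => MeasurableEquiv.sumPiEquivProdPi (fun _ => E)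
    fun i => g (z (e (.inl i)), z (e (.inr i))), ?_, fun P hP => ?_⟩
  · exact (MeasurableEquiv.measurable _).comp (by fun_prop)
  · have : IsProbabilityMeasure ((P.prod P).map g) :=
      Measure.isProbabilityMeasure_map hg.aemeasurable
    exact (measurePreserving_sumPiEquivProdPi fun _ : Fin N ⊕ Fin N => (P.prod P).map g).comp
      (measurePreserving_pairBlocks P he hg)

end Blocks

/-! ### Product bases -/

section Bases

variable {X Y : Type*} [MeasurableSpace X] [MeasurableSpace Y] {J K : Type*}

lemma parseval {μ : Measure X} (b : HilbertBasis J ℝ (Lp ℝ 2 μ)) {u : X → ℝ} (hu : MemLp u 2 μ) :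
    ∫⁻ x, ENNReal.ofReal (u x ^ 2) ∂μ = ∑' j, ENNReal.ofReal ((∫ x, u x * b j x ∂μ) ^ 2) := by
  have hcoef : ∀ j, inner ℝ (hu.toLp u) (b j) = ∫ x, u x * b j x ∂μ := fun j => by
    rw [L2.inner_def]
    refine integral_congr_ae ?_
    filter_upwards [hu.coeFn_toLp] with x hx
    rw [hx]; simp [mul_comm]
  have h := b.hasSum_inner_mul_inner (hu.toLp u) (hu.toLp u)
  have hs : HasSum (fun j => (∫ x, u x * b j x ∂μ) ^ 2) (∫ x, u x ^ 2 ∂μ) := by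
    convert! h using 1
    · ext j
      rw [real_inner_comm (hu.toLp u) (b j), hcoef, sq]
    · rw [L2.inner_def]
      refine integral_congr_ae ?_
      filter_upwards [hu.coeFn_toLp] with x hx
      rw [hx]; simp [sq]
  rw [← ofReal_integral_eq_lintegral_ofReal hu.integrable_sq (Eventually.of_forall fun _ =>
    sq_nonneg _), ← hs.tsum_eq, ENNReal.ofReal_tsum_of_nonneg (fun _ => sq_nonneg _) hs.summable]

variable {μX : Measure X} {μY : Measure Y}

lemma memLp_tensor {u : X → ℝ} {v : Y → ℝ} (hu : MemLp u 2 μX) (hv : MemLp v 2 μY) :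
    MemLp (fun z : X × Y => u z.1 * v z.2) 2 (μX.prod μY) := by
  refine (memLp_two_iff_integrable_sq (hu.1.comp_fst.mul hv.1.comp_snd)).2 ?_
  simp_rw [Pi.mul_apply, mul_pow]
  exact hu.integrable_sq.mul_prod hv.integrable_sq

variable [SigmaFinite μX] [SigmaFinite μY]

lemma integral_basis_mul {μ : Measure X} (b : HilbertBasis J ℝ (Lp ℝ 2 μ)) [DecidableEq J]
    (i j : J) : ∫ x, b i x * b j x ∂μ = if i = j then 1 else 0 := by
  have h := orthonormal_iff_ite.1 b.orthonormal i j
  rw [L2.inner_def] at h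
  rw [← h]
  refine integral_congr_ae (Eventually.of_forall fun x => ?_)
  simp [mul_comm]

lemma integral_section_mul {h : X × Y → ℝ} (hh : MemLp h 2 (μX.prod μY)) {u : X → ℝ} {v : Y → ℝ}
    (hu : MemLp u 2 μX) (hv : MemLp v 2 μY) :
    ∫ x, (∫ y, h (x, y) * v y ∂μY) * u x ∂μX = ∫ z, h z * (u z.1 * v z.2) ∂(μX.prod μY) := by
  have hI : Integrable (fun z => h z * (u z.1 * v z.2)) (μX.prod μY) :=
    hh.integrable_mul (memLp_tensor hu hv)
  rw [integral_prod _ hI]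
  refine integral_congr_ae (Eventually.of_forall fun x => ?_)
  simp only
  rw [← integral_mul_const]
  congr 1
  ext y
  ring

lemma ae_memLp_section {h : X × Y → ℝ} (hh : MemLp h 2 (μX.prod μY)) :
    ∀ᵐ x ∂μX, MemLp (fun y => h (x, y)) 2 μY := by
  filter_upwards [hh.integrable_sq.prod_right_ae, hh.1.prodMk_left] with x hx hm
  exact (memLp_two_iff_integrable_sq hm).2 hx

/-- Parseval in y for almost every x, then in x for each coefficient function. Countability permits
the exchange of sum and integral. -/
lemma parseval_prod [Countable J] [Countable K] (p : HilbertBasis J ℝ (Lp ℝ 2 μX))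
    (q : HilbertBasis K ℝ (Lp ℝ 2 μY)) {h : X × Y → ℝ} (hh : MemLp h 2 (μX.prod μY)) :
    ∫⁻ z, ENNReal.ofReal (h z ^ 2) ∂(μX.prod μY) =
      ∑' j, ∑' k, ENNReal.ofReal ((∫ z, h z * (p j z.1 * q k z.2) ∂(μX.prod μY)) ^ 2) := by
  have hq := fun k => Lp.memLp (q k)
  have hp := fun j => Lp.memLp (p j)
  have hmeas : ∀ k, AEStronglyMeasurable (fun x => ∫ y, h (x, y) * q k y ∂μY) μX := fun k =>
    (hh.1.mul (hq k).1.comp_snd).integral_prod_right'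
  have h1 : ∫⁻ z, ENNReal.ofReal (h z ^ 2) ∂(μX.prod μY) =
      ∑' k, ∫⁻ x, ENNReal.ofReal ((∫ y, h (x, y) * q k y ∂μY) ^ 2) ∂μX := by
    rw [lintegral_prod _ (hh.1.aemeasurable.pow_const 2).ennreal_ofReal,
      ← lintegral_tsum fun k => ((hmeas k).aemeasurable.pow_const 2).ennreal_ofReal]
    refine lintegral_congr_ae ?_
    filter_upwards [ae_memLp_section hh] with x hx
    exact parseval q hx
  -- Each coefficient function is square integrable because its squared norm is one term of the
  -- finite sum in `h1`.
  have hfin : ∀ k, MemLp (fun x => ∫ y, h (x, y) * q k y ∂μY) 2 μX := fun k => by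
    rw [memLp_two_iff_integrable_sq (hmeas k)]
    refine ⟨(hmeas k).pow 2, ?_⟩
    rw [hasFiniteIntegral_iff_ofReal (Eventually.of_forall fun _ => sq_nonneg _)]
    refine lt_of_le_of_lt (ENNReal.le_tsum
      (f := fun k => ∫⁻ x, ENNReal.ofReal ((∫ y, h (x, y) * q k y ∂μY) ^ 2) ∂μX) k) ?_
    rw [← h1]
    exact (hasFiniteIntegral_iff_ofReal (Eventually.of_forall fun _ => sq_nonneg _)).1
      hh.integrable_sq.2
  rw [h1, ENNReal.tsum_comm]
  refine tsum_congr fun k => ?_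
  rw [parseval p (hfin k)]
  refine tsum_congr fun j => ?_
  rw [integral_section_mul hh (hp j) (hq k)]

/-- The finite linear combination `∑ w_{jk} p_j ⊗ q_k`. -/
noncomputable def tensorSum (p : HilbertBasis J ℝ (Lp ℝ 2 μX)) (q : HilbertBasis K ℝ (Lp ℝ 2 μY))
    {S : Finset (J × K)} (w : S → ℝ) (z : X × Y) : ℝ :=
  ∑ a, w a * (p a.1.1 z.1 * q a.1.2 z.2)

lemma memLp_tensorSum (p : HilbertBasis J ℝ (Lp ℝ 2 μX)) (q : HilbertBasis K ℝ (Lp ℝ 2 μY))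
    {S : Finset (J × K)} (w : S → ℝ) : MemLp (tensorSum p q w) 2 (μX.prod μY) :=
  memLp_finsetSum _ fun _ _ => (memLp_tensor (Lp.memLp _) (Lp.memLp _)).const_mul _

lemma integral_tensorSum_sq (p : HilbertBasis J ℝ (Lp ℝ 2 μX)) (q : HilbertBasis K ℝ (Lp ℝ 2 μY))
    {S : Finset (J × K)} (w : S → ℝ) :
    ∫ z, tensorSum p q w z ^ 2 ∂(μX.prod μY) = w ⬝ᵥ w := by
  classical
  have hm : ∀ a : S, MemLp (fun z : X × Y => w a * (p a.1.1 z.1 * q a.1.2 z.2)) 2 (μX.prod μY) :=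
    fun a => (memLp_tensor (Lp.memLp _) (Lp.memLp _)).const_mul _
  have hI : ∀ a b : S, Integrable (fun z : X × Y => (w a * (p a.1.1 z.1 * q a.1.2 z.2)) *
      (w b * (p b.1.1 z.1 * q b.1.2 z.2))) (μX.prod μY) := fun a b => (hm a).integrable_mul (hm b)
  have hval : ∀ a b : S, ∫ z : X × Y, (w a * (p a.1.1 z.1 * q a.1.2 z.2)) *
      (w b * (p b.1.1 z.1 * q b.1.2 z.2)) ∂(μX.prod μY) = if a = b then w a * w a else 0 :=
    fun a b => by
    have e : ∀ z : X × Y, (w a * (p a.1.1 z.1 * q a.1.2 z.2)) *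
      (w b * (p b.1.1 z.1 * q b.1.2 z.2)) = w a * w b * ((p a.1.1 z.1 * p b.1.1 z.1) *
        (q a.1.2 z.2 * q b.1.2 z.2)) := fun z => by ring
    simp_rw [e]
    rw [integral_const_mul, integral_prod_mul (fun x => p a.1.1 x * p b.1.1 x)
      (fun y => q a.1.2 y * q b.1.2 y), integral_basis_mul, integral_basis_mul]
    by_cases hab : a = b
    · subst hab; simp
    · rw [if_neg hab]
      have : ¬ (a.1.1 = b.1.1 ∧ a.1.2 = b.1.2) := fun h => hab (Subtype.ext (Prod.ext h.1 h.2))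
      by_cases h1 : a.1.1 = b.1.1
      · rw [if_neg fun h2 => this ⟨h1, h2⟩]; simp
      · rw [if_neg h1]; simp
  unfold tensorSum
  simp_rw [sq, Finset.sum_mul_sum]
  rw [integral_finsetSum _ fun a _ => integrable_finsetSum _ fun b _ => hI a b]
  simp_rw [integral_finsetSum _ fun b _ => hI _ b, hval]
  simp [dotProduct]

end Bases

/-! ### Laws with a bounded density -/

section Law

variable {X Y : Type*} [MeasurableSpace X] [MeasurableSpace Y]
  {μX : Measure X} {μY : Measure Y} {f : X × Y → ℝ} {A : ℝ}

lemma densities.integrable (hf : f ∈ densities μX μY) : Integrable f (μX.prod μY) :=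
  integrable_of_integral_eq_one hf.2.2

lemma isProbabilityMeasure_densityLaw (hf : f ∈ densities μX μY) :
    IsProbabilityMeasure (densityLaw μX μY f) := by
  refine ⟨?_⟩
  rw [densityLaw, withDensity_apply _ MeasurableSet.univ, Measure.restrict_univ,
    ← ofReal_integral_eq_lintegral_ofReal (integrable_of_integral_eq_one hf.2.2) hf.2.1, hf.2.2,
    ENNReal.ofReal_one]

lemma densityLaw_le (hA : ∀ z, |f z| ≤ A) :
    densityLaw μX μY f ≤ ENNReal.ofReal A • μX.prod μY := by
  rw [← withDensity_const]
  exact withDensity_mono (Eventually.of_forall fun z =>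
    ENNReal.ofReal_le_ofReal ((le_abs_self _).trans (hA z)))

variable [SigmaFinite μX] [SigmaFinite μY]

lemma map_fst_densityLaw (hf : f ∈ densities μX μY) : (densityLaw μX μY f).map Prod.fst =
    μX.withDensity fun x => ENNReal.ofReal (margX μY f x) := by
  ext S hS
  rw [Measure.map_apply measurable_fst hS, densityLaw, withDensity_apply _ (measurable_fst hS),
    withDensity_apply _ hS, ← Set.prod_univ, ← Measure.prod_restrict, Measure.restrict_univ,
    lintegral_prod]
  · refine setLIntegral_congr_fun_ae hS ?_
    filter_upwards [(densities.integrable hf).prod_right_ae, Measure.ae_ae_of_ae_prod hf.2.1]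
      with x hx h0 _
    exact (ofReal_integral_eq_lintegral_ofReal hx h0).symm
  · have h := hf.1.1.aemeasurable.ennreal_ofReal
    refine h.mono_measure ?_
    conv_lhs => rw [← Measure.restrict_univ (μ := μY)]
    rw [Measure.prod_restrict]
    exact Measure.restrict_le_self

lemma map_snd_densityLaw (hf : f ∈ densities μX μY) : (densityLaw μX μY f).map Prod.snd =
    μY.withDensity fun y => ENNReal.ofReal (margY μX f y) := by
  ext S hS
  rw [Measure.map_apply measurable_snd hS, densityLaw, withDensity_apply _ (measurable_snd hS),
    withDensity_apply _ hS, ← Set.univ_prod, ← Measure.prod_restrict, Measure.restrict_univ,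
    lintegral_prod_symm]
  · refine setLIntegral_congr_fun_ae hS ?_
    have h0 : ∀ᵐ z ∂(μY.prod μX), 0 ≤ f z.swap :=
      (Measure.measurePreserving_swap (μ := μY) (ν := μX)).quasiMeasurePreserving.ae hf.2.1
    filter_upwards [(densities.integrable hf).prod_left_ae, Measure.ae_ae_of_ae_prod h0]
      with y hy h0 _
    exact (ofReal_integral_eq_lintegral_ofReal hy h0).symm
  · have h := hf.1.1.aemeasurable.ennreal_ofReal
    refine h.mono_measure ?_
    conv_lhs => rw [← Measure.restrict_univ (μ := μX)]
    rw [Measure.prod_restrict]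
    exact Measure.restrict_le_self

lemma ae_margX_nonneg (hf : f ∈ densities μX μY) : 0 ≤ᵐ[μX] margX μY f := by
  filter_upwards [Measure.ae_ae_of_ae_prod hf.2.1] with x h0
  exact integral_nonneg_of_ae h0

lemma ae_margY_nonneg (hf : f ∈ densities μX μY) : 0 ≤ᵐ[μY] margY μX f := by
  have h0 : ∀ᵐ z ∂(μY.prod μX), 0 ≤ f z.swap :=
    (Measure.measurePreserving_swap (μ := μY) (ν := μX)).quasiMeasurePreserving.ae hf.2.1
  filter_upwards [Measure.ae_ae_of_ae_prod h0] with x h0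
  exact integral_nonneg_of_ae h0

lemma withDensity_ofReal_le {μ : Measure X} {g : X → ℝ} (hA : ∀ x, |g x| ≤ A) :
    (μ.withDensity fun x => ENNReal.ofReal (g x)) ≤ ENNReal.ofReal A • μ := by
  rw [← withDensity_const]
  exact withDensity_mono (Eventually.of_forall fun z =>
    ENNReal.ofReal_le_ofReal ((le_abs_self _).trans (hA z)))

lemma integral_withDensity_ofReal {μ : Measure X} {g : X → ℝ} (hg : AEMeasurable g μ)
    (h0 : 0 ≤ᵐ[μ] g) (u : X → ℝ) :
    ∫ x, u x ∂(μ.withDensity fun x => ENNReal.ofReal (g x)) = ∫ x, g x * u x ∂μ := by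
  rw [integral_withDensity_eq_integral_toReal_smul₀ hg.ennreal_ofReal
    (Eventually.of_forall fun _ => ENNReal.ofReal_lt_top)]
  refine integral_congr_ae ?_
  filter_upwards [h0] with x hx
  rw [ENNReal.toReal_ofReal hx, smul_eq_mul]

lemma memLp_two_of_bounded {μ : Measure X} {g : X → ℝ} (hg : Integrable g μ)
    (hA : ∀ x, |g x| ≤ A) : MemLp g 2 μ := by
  rw [memLp_two_iff_integrable_sq hg.1]
  refine (hg.norm.const_mul A).mono' (hg.1.pow 2) (Eventually.of_forall fun x => ?_)
  rw [Real.norm_eq_abs, Real.norm_eq_abs, abs_of_nonneg (sq_nonneg (g x)), ← sq_abs, sq]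
  exact mul_le_mul_of_nonneg_right (hA x) (abs_nonneg _)

lemma memLp_margX (hf : f ∈ densities μX μY) (hX : ∀ x, |margX μY f x| ≤ A) :
    MemLp (margX μY f) 2 μX :=
  memLp_two_of_bounded (densities.integrable hf).integral_prod_left hX

lemma memLp_margY (hf : f ∈ densities μX μY) (hY : ∀ y, |margY μX f y| ≤ A) :
    MemLp (margY μX f) 2 μY :=
  memLp_two_of_bounded (densities.integrable hf).integral_prod_right hY

lemma prod_marginals_le (hf : f ∈ densities μX μY) (hX : ∀ x, |margX μY f x| ≤ A)
    (hY : ∀ y, |margY μX f y| ≤ A) :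
    ((densityLaw μX μY f).map Prod.fst).prod ((densityLaw μX μY f).map Prod.snd) ≤
      (ENNReal.ofReal A * ENNReal.ofReal A) • μX.prod μY := by
  rw [map_fst_densityLaw hf, map_snd_densityLaw hf]
  refine (Measure.prod_mono (withDensity_ofReal_le hX) (withDensity_ofReal_le hY)).trans ?_
  rw [Measure.prod_smul_left, Measure.prod_smul_right, smul_smul]

/-! ### The antisymmetrised kernel -/

/-- The antisymmetrised difference of `h` over a pair of observations. -/
noncomputable def pairDiff (h : X × Y → ℝ) (z : (X × Y) × (X × Y)) : ℝ :=
  (h z.1 + h z.2 - h (z.1.1, z.2.2) - h (z.2.1, z.1.2)) / 2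

lemma measurePreserving_cross (P : Measure (X × Y)) [IsProbabilityMeasure P] :
    MeasurePreserving (fun z : (X × Y) × (X × Y) => (z.1.1, z.2.2)) (P.prod P)
      ((P.map Prod.fst).prod (P.map Prod.snd)) :=
  (measurable_fst.measurePreserving P).prod (measurable_snd.measurePreserving P)

lemma measurePreserving_cross' (P : Measure (X × Y)) [IsProbabilityMeasure P] :
    MeasurePreserving (fun z : (X × Y) × (X × Y) => (z.2.1, z.1.2)) (P.prod P)
      ((P.map Prod.fst).prod (P.map Prod.snd)) :=
  (measurePreserving_cross P).comp Measure.measurePreserving_swap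

lemma integral_comp_eq {α β : Type*} [MeasurableSpace α] [MeasurableSpace β]
    {μ : Measure α} {ν : Measure β} {φ : α → β} (h : MeasurePreserving φ μ ν) {g : β → ℝ}
    (hg : AEStronglyMeasurable g ν) : ∫ x, g (φ x) ∂μ = ∫ y, g y ∂ν := by
  rw [← h.map_eq, integral_map h.aemeasurable (h.map_eq ▸ hg)]

variable {P : Measure (X × Y)} [IsProbabilityMeasure P] {h : X × Y → ℝ}

lemma memLp_pairDiff (h1 : MemLp h 2 P)
    (h2 : MemLp h 2 ((P.map Prod.fst).prod (P.map Prod.snd))) :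
    MemLp (pairDiff h) 2 (P.prod P) := by
  have a1 := h1.comp_measurePreserving (measurePreserving_fst (μ := P) (ν := P))
  have a2 := h1.comp_measurePreserving (measurePreserving_snd (μ := P) (ν := P))
  have a3 := h2.comp_measurePreserving (measurePreserving_cross P)
  have a4 := h2.comp_measurePreserving (measurePreserving_cross' P)
  have := (((a1.add a2).sub a3).sub a4).const_mul (1 / 2)
  exact this.ae_eq (Eventually.of_forall fun z => by simp [pairDiff]; ring)

/-- The crossed points (x, y') and (x', y) come from two independent observations, so their law is
the product of the marginals. -/
lemma integral_pairDiff (h1 : Integrable h P)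
    (h2 : Integrable h ((P.map Prod.fst).prod (P.map Prod.snd))) :
    ∫ z, pairDiff h z ∂(P.prod P) =
      ∫ z, h z ∂P - ∫ z, h z ∂((P.map Prod.fst).prod (P.map Prod.snd)) := by
  have m1 := measurePreserving_fst (μ := P) (ν := P)
  have m2 := measurePreserving_snd (μ := P) (ν := P)
  have m3 := measurePreserving_cross P
  have m4 := measurePreserving_cross' P
  have a1 := m1.integrable_comp_of_integrable h1
  have a2 := m2.integrable_comp_of_integrable h1
  have a3 := m3.integrable_comp_of_integrable h2
  have a4 := m4.integrable_comp_of_integrable h2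
  simp only [Function.comp_def] at a1 a2 a3 a4
  unfold pairDiff
  have b2 : Integrable (fun z : (X × Y) × (X × Y) => h z.1 + h z.2) (P.prod P) := a1.add a2
  have b3 : Integrable (fun z : (X × Y) × (X × Y) => h z.1 + h z.2 - h (z.1.1, z.2.2))
    (P.prod P) := b2.sub a3
  rw [integral_div, integral_sub b3 a4, integral_sub b2 a3, integral_add a1 a2,
    integral_comp_eq m1 h1.1, integral_comp_eq m2 h1.1,
    integral_comp_eq m3 h2.1, integral_comp_eq m4 h2.1]
  ring

lemma integral_pairDiff_sq_le (h1 : MemLp h 2 P)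
    (h2 : MemLp h 2 ((P.map Prod.fst).prod (P.map Prod.snd))) :
    ∫ z, pairDiff h z ^ 2 ∂(P.prod P) ≤
      2 * ∫ z, h z ^ 2 ∂P + 2 * ∫ z, h z ^ 2 ∂((P.map Prod.fst).prod (P.map Prod.snd)) := by
  have m1 := measurePreserving_fst (μ := P) (ν := P)
  have m2 := measurePreserving_snd (μ := P) (ν := P)
  have m3 := measurePreserving_cross P
  have m4 := measurePreserving_cross' P
  have s1 := h1.integrable_sq
  have s2 := h2.integrable_sq
  have a1 := m1.integrable_comp_of_integrable s1
  have a2 := m2.integrable_comp_of_integrable s1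
  have a3 := m3.integrable_comp_of_integrable s2
  have a4 := m4.integrable_comp_of_integrable s2
  simp only [Function.comp_def] at a1 a2 a3 a4
  have hle : ∀ z, pairDiff h z ^ 2 ≤
      h z.1 ^ 2 + h z.2 ^ 2 + h (z.1.1, z.2.2) ^ 2 + h (z.2.1, z.1.2) ^ 2 := fun z => by
    unfold pairDiff
    set a := h z.1
    set b := h z.2
    set c := h (z.1.1, z.2.2)
    set d := h (z.2.1, z.1.2)
    nlinarith [sq_nonneg (a - b), sq_nonneg (a + c), sq_nonneg (a + d), sq_nonneg (b + c),
      sq_nonneg (b + d), sq_nonneg (c - d)]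
  have b2 : Integrable (fun z : (X × Y) × (X × Y) => h z.1 ^ 2 + h z.2 ^ 2) (P.prod P) := a1.add a2
  have b3 : Integrable (fun z : (X × Y) × (X × Y) =>
    h z.1 ^ 2 + h z.2 ^ 2 + h (z.1.1, z.2.2) ^ 2) (P.prod P) := b2.add a3
  refine (integral_mono (memLp_pairDiff h1 h2).integrable_sq (b3.add a4) hle).trans (le_of_eq ?_)
  simp only [Pi.add_apply]
  rw [integral_add b3 a4, integral_add b2 a3, integral_add a1 a2,
    integral_comp_eq m1 s1.1 (g := fun z => h z ^ 2),
    integral_comp_eq m2 s1.1 (g := fun z => h z ^ 2),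
    integral_comp_eq m3 s2.1 (g := fun z => h z ^ 2),
    integral_comp_eq m4 s2.1 (g := fun z => h z ^ 2)]
  ring

lemma measurable_pairDiff (hh : Measurable h) : Measurable (pairDiff h) := by
  unfold pairDiff; fun_prop

lemma pairDiff_swap (z : (X × Y) × (X × Y)) :
    pairDiff h ((z.1.1, z.2.2), (z.2.1, z.1.2)) = -pairDiff h z := by
  simp only [pairDiff]; ring

/-- It suffices to compare both measures on products of rectangles, where the two Y-factors are
merely interchanged. -/
lemma measurePreserving_exchange {P₁ : Measure X} {P₂ : Measure Y} [IsProbabilityMeasure P₁]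
    [IsProbabilityMeasure P₂] :
    MeasurePreserving (fun z : (X × Y) × (X × Y) => ((z.1.1, z.2.2), (z.2.1, z.1.2)))
      ((P₁.prod P₂).prod (P₁.prod P₂)) ((P₁.prod P₂).prod (P₁.prod P₂)) := by
  have hmeas : Measurable
      (fun z : (X × Y) × (X × Y) => ((z.1.1, z.2.2), (z.2.1, z.1.2))) := by fun_prop
  refine ⟨hmeas, ?_⟩
  have span : (P₁.prod P₂).FiniteSpanningSetsIn
      (Set.image2 (· ×ˢ ·) {s : Set X | MeasurableSet s} {t : Set Y | MeasurableSet t}) :=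
    P₁.toFiniteSpanningSetsIn.prod P₂.toFiniteSpanningSetsIn
  refine (Measure.prod_eq_generateFrom generateFrom_prod generateFrom_prod isPiSystem_prod
    isPiSystem_prod span span ?_).symm
  rintro _ ⟨s, hs, t, ht, rfl⟩ _ ⟨u, hu, v, hv, rfl⟩
  rw [Measure.map_apply hmeas ((hs.prod ht).prod (hu.prod hv))]
  have e : (fun z : (X × Y) × (X × Y) => ((z.1.1, z.2.2), (z.2.1, z.1.2))) ⁻¹'
      ((s ×ˢ t) ×ˢ (u ×ˢ v)) = (s ×ˢ v) ×ˢ (u ×ˢ t) := by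
    ext z; simp only [Set.mem_preimage, Set.mem_prod]; tauto
  rw [e]
  simp only [Measure.prod_prod]
  ring

end Law

/-! ### Law of the kernel vector under the null hypothesis and under bounded densities. -/

section Kernel

variable {X Y : Type*} [MeasurableSpace X] [MeasurableSpace Y] {J K : Type*}
  {μX : Measure X} {μY : Measure Y}
  (p : HilbertBasis J ℝ (Lp ℝ 2 μX)) (q : HilbertBasis K ℝ (Lp ℝ 2 μY)) (S : Finset (J × K))

/-- The vector of antisymmetrised kernels `(p_j(x) - p_j(x'))(q_k(y) - q_k(y')) / 2`, for `(j, k)`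
in a finite set. -/
noncomputable def kernelVec (z : (X × Y) × (X × Y)) (a : S) : ℝ :=
  pairDiff (fun z => p a.1.1 z.1 * q a.1.2 z.2) z

lemma measurable_tensor (j : J) (k : K) : Measurable fun z : X × Y => p j z.1 * q k z.2 :=
  ((Lp.stronglyMeasurable (p j)).measurable.comp measurable_fst).mul
    ((Lp.stronglyMeasurable (q k)).measurable.comp measurable_snd)

lemma measurable_kernelVec : Measurable (kernelVec p q S) :=
  measurable_pi_lambda _ fun _ => measurable_pairDiff (measurable_tensor p q _ _)

/-- `P` may be singular to the reference measure: the kernel is built from fixed measurable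
representatives, so its antisymmetry holds at every point. -/
lemma map_kernelVec_neg {P : Measure (X × Y)} (hP : P ∈ nullLaws X Y) :
    ((P.prod P).map (kernelVec p q S)).map (fun z => -z) = (P.prod P).map (kernelVec p q S) := by
  obtain ⟨hP1, hP2⟩ := hP
  have i1 : IsProbabilityMeasure (P.map Prod.fst) :=
    Measure.isProbabilityMeasure_map measurable_fst.aemeasurable
  have i2 : IsProbabilityMeasure (P.map Prod.snd) :=
    Measure.isProbabilityMeasure_map measurable_snd.aemeasurable
  have hprod : P = (P.map Prod.fst).prod (P.map Prod.snd) := by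
    have := hP2.map_prod_eq_prod_map_map measurable_fst.aemeasurable measurable_snd.aemeasurable
    rw [← this]
    exact Measure.map_id.symm
  have hex := measurePreserving_exchange (P₁ := P.map Prod.fst) (P₂ := P.map Prod.snd)
  rw [← hprod] at hex
  have hm := measurable_kernelVec p q S
  conv_rhs => rw [← hex.map_eq]
  rw [Measure.map_map measurable_neg hm, Measure.map_map hm hex.measurable]
  congr 1
  ext z a
  exact (pairDiff_swap z).symm

lemma dotProduct_kernelVec [SigmaFinite μX] [SigmaFinite μY] (w : S → ℝ)
    (z : (X × Y) × (X × Y)) :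
    w ⬝ᵥ kernelVec p q S z = pairDiff (tensorSum p q w) z := by
  simp only [dotProduct, kernelVec, pairDiff, tensorSum, ← Finset.sum_add_distrib,
    ← Finset.sum_sub_distrib, Finset.sum_div]
  exact Finset.sum_congr rfl fun a _ => by ring

variable [SigmaFinite μX] [SigmaFinite μY] {f : X × Y → ℝ} {A : ℝ}

lemma memLp_densityLaw (hA : ∀ z, |f z| ≤ A) {h : X × Y → ℝ} (hh : MemLp h 2 (μX.prod μY)) :
    MemLp h 2 (densityLaw μX μY f) :=
  hh.of_measure_le_smul ENNReal.ofReal_ne_top (densityLaw_le hA)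

lemma memLp_prod_marginals (hf : f ∈ densities μX μY)
    (hX : ∀ x, |margX μY f x| ≤ A) (hY : ∀ y, |margY μX f y| ≤ A) {h : X × Y → ℝ}
    (hh : MemLp h 2 (μX.prod μY)) :
    MemLp h 2 (((densityLaw μX μY f).map Prod.fst).prod ((densityLaw μX μY f).map Prod.snd)) :=
  hh.of_measure_le_smul (ENNReal.mul_ne_top ENNReal.ofReal_ne_top ENNReal.ofReal_ne_top)
    (prod_marginals_le hf hX hY)

lemma integral_sq_le_of_le_smul {α : Type*} [MeasurableSpace α] {μ ν : Measure α} {c : ℝ≥0∞}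
    (hc : c ≠ ∞) (hν : ν ≤ c • μ) {h : α → ℝ} (hh : MemLp h 2 μ) :
    ∫ x, h x ^ 2 ∂ν ≤ c.toReal * ∫ x, h x ^ 2 ∂μ := by
  refine (integral_mono_measure hν (Eventually.of_forall fun x => sq_nonneg _)
    (hh.integrable_sq.smul_measure hc)).trans (le_of_eq ?_)
  rw [integral_smul_measure, smul_eq_mul]

/-- The second-moment bound does not involve `S`: by orthonormality `tensorSum p q w` has squared
norm w·w, and the relevant laws are dominated by A and A² times the reference measure. -/
lemma kernelVec_moments (hf : f ∈ densities μX μY) (hA : ∀ z, |f z| ≤ A)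
    (hX : ∀ x, |margX μY f x| ≤ A) (hY : ∀ y, |margY μX f y| ≤ A) (hA0 : 0 ≤ A) :
    (∀ a, MemLp (fun z : S → ℝ => z a) 2
      (((densityLaw μX μY f).prod (densityLaw μX μY f)).map (kernelVec p q S))) ∧
    (∀ a, ∫ z, z a ∂(((densityLaw μX μY f).prod (densityLaw μX μY f)).map (kernelVec p q S)) =
      coeff p q f a.1.1 a.1.2 - coeffX μY p f a.1.1 * coeffY μX q f a.1.2) ∧
    (∀ w : S → ℝ, ∫ z, (w ⬝ᵥ z) ^ 2
      ∂(((densityLaw μX μY f).prod (densityLaw μX μY f)).map (kernelVec p q S)) ≤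
        2 * (A + A ^ 2) * (w ⬝ᵥ w)) := by
  have hP := isProbabilityMeasure_densityLaw hf
  have hm := measurable_kernelVec p q S
  have i1 : IsProbabilityMeasure ((densityLaw μX μY f).map Prod.fst) :=
    Measure.isProbabilityMeasure_map measurable_fst.aemeasurable
  have i2 : IsProbabilityMeasure ((densityLaw μX μY f).map Prod.snd) :=
    Measure.isProbabilityMeasure_map measurable_snd.aemeasurable
  have hT : ∀ j k, MemLp (fun z : X × Y => p j z.1 * q k z.2) 2 (μX.prod μY) := fun j k =>
    memLp_tensor (Lp.memLp _) (Lp.memLp _)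
  have hT1 := fun j k => memLp_densityLaw hA (hT j k)
  have hT2 := fun j k => memLp_prod_marginals hf hX hY (hT j k)
  refine ⟨fun a => ?_, fun a => ?_, fun w => ?_⟩
  · rw [memLp_map_measure_iff (measurable_pi_apply a).aestronglyMeasurable hm.aemeasurable]
    exact memLp_pairDiff (hT1 _ _) (hT2 _ _)
  · rw [integral_map hm.aemeasurable (measurable_pi_apply a).aestronglyMeasurable]
    refine (integral_pairDiff ((hT1 _ _).integrable one_le_two)
      ((hT2 _ _).integrable one_le_two)).trans ?_
    rw [integral_prod_mul (fun x => p a.1.1 x) (fun y => q a.1.2 y), map_fst_densityLaw hf,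
      map_snd_densityLaw hf,
      integral_withDensity_ofReal (memLp_margX hf hX).1.aemeasurable (ae_margX_nonneg hf),
      integral_withDensity_ofReal (memLp_margY hf hY).1.aemeasurable (ae_margY_nonneg hf),
      densityLaw, integral_withDensity_ofReal hf.1.1.aemeasurable hf.2.1]
    rfl
  · rw [integral_map hm.aemeasurable
      ((measurable_dotProduct_right w).pow_const 2).aestronglyMeasurable]
    simp_rw [dotProduct_kernelVec]
    have hS := memLp_tensorSum p q w
    refine (integral_pairDiff_sq_le (memLp_densityLaw hA hS)
      (memLp_prod_marginals hf hX hY hS)).trans ?_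
    have b1 := integral_sq_le_of_le_smul ENNReal.ofReal_ne_top (densityLaw_le hA) hS
    have b2 := integral_sq_le_of_le_smul
      (ENNReal.mul_ne_top ENNReal.ofReal_ne_top ENNReal.ofReal_ne_top)
      (prod_marginals_le hf hX hY) hS
    rw [integral_tensorSum_sq, ENNReal.toReal_ofReal hA0] at b1
    rw [integral_tensorSum_sq, ENNReal.toReal_mul, ENNReal.toReal_ofReal hA0] at b2
    linarith

/-- Parseval's identity for the dependence functional. -/
lemma ofReal_dependence [Countable J] [Countable K] (hf : f ∈ densities μX μY)
    (hX : ∀ x, |margX μY f x| ≤ A) (hY : ∀ y, |margY μX f y| ≤ A) :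
    ENNReal.ofReal (dependence μX μY f) =
      ∑' j, ∑' k, ENNReal.ofReal ((coeff p q f j k - coeffX μY p f j * coeffY μX q f k) ^ 2) := by
  have hm := memLp_tensor (memLp_margX hf hX) (memLp_margY hf hY)
  have hh := hf.1.sub hm
  refine (ofReal_integral_eq_lintegral_ofReal hh.integrable_sq
    (Eventually.of_forall fun _ => sq_nonneg _)).trans ((parseval_prod p q hh).trans ?_)
  refine tsum_congr fun j => tsum_congr fun k => ?_
  congr 2
  have hT : MemLp (fun z : X × Y => p j z.1 * q k z.2) 2 (μX.prod μY) :=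
    memLp_tensor (Lp.memLp _) (Lp.memLp _)
  have I1 : Integrable (fun z => f z * (p j z.1 * q k z.2)) (μX.prod μY) :=
    hf.1.integrable_mul hT
  have I2 : Integrable (fun z : X × Y => (margX μY f z.1 * margY μX f z.2) *
    (p j z.1 * q k z.2)) (μX.prod μY) := hm.integrable_mul hT
  simp only [Pi.sub_apply, sub_mul]
  rw [integral_sub I1 I2, coeff, coeffX, coeffY, ← integral_prod_mul]
  congr 2
  ext z
  ring

end Kernel

/-! ### Counting indices -/

lemma exp_logCount {u : ℝ} {N : ℕ} (hN : u < N + 1) : Real.exp (logCount u) =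
    ∏ ℓ ∈ Finset.range N, (1 + (⌊u / ((ℓ : ℝ) + 1) ^ 2⌋₊ : ℝ)) := by
  rw [logCount_eq_sum hN, Real.exp_sum]
  exact Finset.prod_congr rfl fun ℓ _ => Real.exp_log (by positivity)

/-- The constraint splits over coordinates into m_ℓ ≤ ⌊u/ℓ²⌋, so the count is a product. -/
lemma exists_finset_seqSize_le (u : ℝ) : ∃ T : Finset (ℕ+ →₀ ℕ),
    (∀ m, (seqSize m : ℝ) ≤ u → m ∈ T) ∧ (T.card : ℝ) = Real.exp (logCount u) := by
  classical
  obtain ⟨N, hN⟩ := exists_nat_gt u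
  set s : Finset ℕ+ := (Finset.range N).map ⟨Nat.succPNat, Nat.succPNat_injective⟩ with hs
  refine ⟨s.finsupp fun ℓ => Finset.range (1 + ⌊u / (ℓ : ℝ) ^ 2⌋₊), fun m hm => ?_, ?_⟩
  · have hle : ∀ ℓ ∈ m.support, ((ℓ : ℕ) : ℝ) ^ 2 * m ℓ ≤ u := fun ℓ hℓ => by
      have h : (ℓ : ℕ) ^ 2 * m ℓ ≤ seqSize m :=
        Finset.le_sup (f := fun ℓ : ℕ+ => (ℓ : ℕ) ^ 2 * m ℓ) hℓ
      have h' : (((ℓ : ℕ) ^ 2 * m ℓ : ℕ) : ℝ) ≤ seqSize m := by exact_mod_cast h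
      push_cast at h'
      exact h'.trans hm
    rw [Finset.mem_finsupp_iff]
    refine ⟨fun ℓ hℓ => ?_, fun ℓ _ => ?_⟩
    · have h1 := hle ℓ hℓ
      have h2 : (1 : ℝ) ≤ m ℓ := by
        exact_mod_cast Nat.one_le_iff_ne_zero.2 (Finsupp.mem_support_iff.1 hℓ)
      have h3 : (1 : ℝ) ≤ (ℓ : ℕ) := by exact_mod_cast (one_le : 1 ≤ ℓ)
      have h4 : ((ℓ : ℕ) : ℝ) ≤ u := by
        nlinarith [mul_nonneg (sq_nonneg ((ℓ : ℕ) : ℝ)) (sub_nonneg.2 h2)]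
      have h5 : (ℓ : ℕ) < N := by exact_mod_cast h4.trans_lt hN
      rw [hs, Finset.mem_map]
      refine ⟨ℓ.natPred, Finset.mem_range.2 ?_, PNat.succPNat_natPred ℓ⟩
      have := PNat.natPred_add_one ℓ
      lia
    · rw [Finset.mem_range, add_comm, Nat.lt_add_one_iff]
      by_cases hℓ : ℓ ∈ m.support
      · refine Nat.le_floor ?_
        rw [le_div_iff₀ (by positivity), mul_comm]
        exact hle ℓ hℓ
      · rw [Finsupp.notMem_support_iff.1 hℓ]; exact Nat.zero_le _
  · rw [Finset.card_finsupp, hs, Finset.prod_map, exp_logCount (hN.trans (lt_add_one _))]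
    push_cast
    refine Finset.prod_congr rfl fun ℓ _ => ?_
    simp

/-- The factor 2 counts the binary component; erasing the zero sequence accounts for the -1 in
`countM`. -/
lemma exists_finset_size_le {u : ℝ} (hu : 0 ≤ u) : ∃ F : Finset Idx,
    (∀ j : Idx, 0 < j.size → (j.size : ℝ) ≤ u → j ∈ F) ∧ (F.card : ℝ) ≤ 2 * countM u := by
  classical
  obtain ⟨T, hT, hcard⟩ := exists_finset_seqSize_le u
  refine ⟨((Finset.univ : Finset (Fin 2)) ×ˢ T.erase 0).subtype (· ≠ (1, 0)),
    fun j h0 hj => ?_, ?_⟩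
  · rw [Finset.mem_subtype, Finset.mem_product, Finset.mem_erase]
    refine ⟨Finset.mem_univ _, fun h => ?_, hT _ hj⟩
    rw [Idx.size, h] at h0
    simp [seqSize] at h0
  · have h0 : (0 : ℕ+ →₀ ℕ) ∈ T := hT 0 (by simpa [seqSize] using hu)
    have hpos : 1 ≤ T.card := Finset.card_pos.2 ⟨0, h0⟩
    have hle : (((Finset.univ : Finset (Fin 2)) ×ˢ T.erase 0).subtype (· ≠ (1, 0))).card ≤
        2 * (T.card - 1) := by
      rw [Finset.card_subtype]
      refine (Finset.card_filter_le _ _).trans ?_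
      rw [Finset.card_product, Finset.card_erase_of_mem h0]
      simp
    have : ((2 * (T.card - 1) : ℕ) : ℝ) = 2 * countM u := by
      rw [countM_eq, ← hcard]; push_cast [hpos]; ring
    rw [← this]
    exact_mod_cast hle

/-! ### Truncation bias -/

section Bias

variable {X Y J K : Type*} [MeasurableSpace X] [MeasurableSpace Y] {μX : Measure X}
  {μY : Measure Y} [SigmaFinite μX] [SigmaFinite μY] [Countable J] [Countable K]

/-- Outside `S` each squared coefficient is at most τ⁻² times its term in `smoothness`; Parseval
then bounds the discarded part of the dependence. -/
lemma sq_le_sum_add_of_mem_alternatives (p : HilbertBasis J ℝ (Lp ℝ 2 μX))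
    (q : HilbertBasis K ℝ (Lp ℝ 2 μY)) {θ : J → K → ℝ≥0∞} {r A ρ τ : ℝ} {f : X × Y → ℝ}
    (hf : f ∈ alternatives p q θ r A ρ) {S : Finset (J × K)} (hτ : 0 < τ)
    (hθ : ∀ j k, (j, k) ∉ S → ENNReal.ofReal τ ≤ θ j k) :
    ρ ^ 2 ≤ ∑ a : S, (coeff p q f a.1.1 a.1.2 -
      coeffX μY p f a.1.1 * coeffY μX q f a.1.2) ^ 2 + r ^ 2 / τ ^ 2 := by
  classical
  obtain ⟨hd, hρ, hs, -, hX, hY⟩ := hf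
  set δ : J → K → ℝ := fun j k => coeff p q f j k - coeffX μY p f j * coeffY μX q f k with hδ
  have hpt : ∀ j k, ENNReal.ofReal (δ j k ^ 2) ≤
      (if (j, k) ∈ S then ENNReal.ofReal (δ j k ^ 2) else 0) +
        ENNReal.ofReal (1 / τ ^ 2) * (θ j k ^ 2 * ENNReal.ofReal (δ j k ^ 2)) := fun j k => by
    split_ifs with h
    · exact le_self_add
    · rw [zero_add, ← mul_assoc]
      refine le_mul_of_one_le_left zero_le ?_
      calc (1 : ℝ≥0∞) = ENNReal.ofReal (1 / τ ^ 2) * ENNReal.ofReal τ ^ 2 := by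
            rw [← ENNReal.ofReal_pow hτ.le, ← ENNReal.ofReal_mul (by positivity),
              one_div_mul_cancel (by positivity), ENNReal.ofReal_one]
        _ ≤ _ := by gcongr; exact hθ j k h
  have hsum : ∑' j, ∑' k, (if (j, k) ∈ S then ENNReal.ofReal (δ j k ^ 2) else 0) =
      ENNReal.ofReal (∑ a : S, δ a.1.1 a.1.2 ^ 2) := by
    rw [← ENNReal.tsum_prod (f := fun j k => if (j, k) ∈ S then ENNReal.ofReal (δ j k ^ 2) else 0),
      tsum_eq_sum (s := S) fun a ha => if_neg ha,
      ENNReal.ofReal_sum_of_nonneg fun _ _ => sq_nonneg _, ← Finset.sum_coe_sort]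
    exact Finset.sum_congr rfl fun a _ => if_pos a.2
  have hmain : ENNReal.ofReal (dependence μX μY f) ≤
      ENNReal.ofReal (∑ a : S, δ a.1.1 a.1.2 ^ 2 + r ^ 2 / τ ^ 2) := by
    rw [ofReal_dependence p q hd hX hY,
      ENNReal.ofReal_add (Finset.sum_nonneg fun _ _ => sq_nonneg _) (by positivity), ← hsum]
    refine (ENNReal.tsum_le_tsum fun j => ENNReal.tsum_le_tsum fun k => hpt j k).trans ?_
    simp_rw [ENNReal.tsum_add, ENNReal.tsum_mul_left]
    refine add_le_add le_rfl ?_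
    rw [show r ^ 2 / τ ^ 2 = 1 / τ ^ 2 * r ^ 2 by ring, ENNReal.ofReal_mul (by positivity)]
    exact mul_le_mul_right hs _
  exact hρ.trans ((ENNReal.ofReal_le_ofReal_iff (add_nonneg (Finset.sum_nonneg fun _ _ =>
    sq_nonneg _) (by positivity))).1 hmain)

end Bias

lemma le_exp_mul_sqrt {σ L : ℝ} (hσ : 0 < σ) {k : ℕ} (h : L ^ 2 / (4 * σ ^ 2) < k) :
    Real.exp (L / 2) ≤ Real.exp (σ * √(k : ℝ)) := by
  rw [Real.exp_le_exp]
  have h1 : |L| / (2 * σ) ≤ √(k : ℝ) := by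
    refine Real.le_sqrt_of_sq_le ?_
    rw [div_pow, sq_abs, mul_pow]
    norm_num
    exact h.le
  rw [div_le_iff₀ (by positivity)] at h1
  linarith [le_abs_self L]

/-- For L ≥ 0 the cut-offs are the sizes at which the exponential weights reach exp(L/2). Indices of
size zero can be left out of `S` since their weight is infinite. -/
lemma exists_truncation {sX sY : ℝ} (hX : 0 < sX) (hY : 0 < sY) (L : ℝ) :
    ∃ S : Finset (Idx × Idx),
      (S.card : ℝ) ≤ 4 * (countM (L ^ 2 / (4 * sX ^ 2)) * countM (L ^ 2 / (4 * sY ^ 2))) ∧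
      ∀ j k, (j, k) ∉ S → ENNReal.ofReal (Real.exp (L / 2)) ≤ weight sX sY j k := by
  obtain ⟨F, hF, hFc⟩ := exists_finset_size_le (u := L ^ 2 / (4 * sX ^ 2)) (by positivity)
  obtain ⟨G, hG, hGc⟩ := exists_finset_size_le (u := L ^ 2 / (4 * sY ^ 2)) (by positivity)
  refine ⟨F ×ˢ G, ?_, fun j k hjk => ?_⟩
  · rw [Finset.card_product]
    push_cast
    calc _ ≤ (2 * countM (L ^ 2 / (4 * sX ^ 2))) * (2 * countM (L ^ 2 / (4 * sY ^ 2))) :=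
          mul_le_mul hFc hGc (Nat.cast_nonneg _) (mul_nonneg zero_le_two countM_nonneg)
      _ = _ := by ring
  · rw [weight]
    split_ifs with h0
    · rw [lt_min_iff] at h0
      refine ENNReal.ofReal_le_ofReal ?_
      by_cases hj : (j.size : ℝ) ≤ L ^ 2 / (4 * sX ^ 2)
      · have hk : ¬ (k.size : ℝ) ≤ L ^ 2 / (4 * sY ^ 2) := fun hk =>
          hjk (Finset.mem_product.2 ⟨hF j h0.1 hj, hG k h0.2 hk⟩)
        exact (le_exp_mul_sqrt hY (not_le.1 hk)).trans (le_max_right _ _)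
      · exact (le_exp_mul_sqrt hX (not_le.1 hj)).trans (le_max_left _ _)
    · exact le_top

/-! ### Risk of the test -/

section Risk

variable {X Y J K : Type*} [MeasurableSpace X] [MeasurableSpace Y]

lemma expect_indicator {n : ℕ} (P : Measure (X × Y)) {R : Set (Fin n → X × Y)}
    (hR : MeasurableSet R) : expect P (R.indicator 1) = Measure.pi (fun _ : Fin n => P) R := by
  rw [expect, ← lintegral_indicator_one hR]
  refine lintegral_congr fun z => ?_
  by_cases hz : z ∈ R <;> simp [hz]

lemma expect_one_sub_indicator {n : ℕ} (P : Measure (X × Y)) {R : Set (Fin n → X × Y)}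
    (hR : MeasurableSet R) :
    expect P (fun z => 1 - R.indicator 1 z) = Measure.pi (fun _ : Fin n => P) Rᶜ := by
  rw [← expect_indicator P hR.compl]
  congr 1
  ext z
  by_cases hz : z ∈ R <;> simp [hz]

variable {μX : Measure X} {μY : Measure Y} [SigmaFinite μX] [SigmaFinite μY]

lemma minimaxRisk_le [Countable J] [Countable K] (p : HilbertBasis J ℝ (Lp ℝ 2 μX))
    (q : HilbertBasis K ℝ (Lp ℝ 2 μY)) {θ : J → K → ℝ≥0∞} {r A ρ τ α β M κ : ℝ} {n N : ℕ}
    (hα : 0 < α) (hα1 : α < 1) (hβ : 0 < β) (hA : 0 < A) (hN : 4 * N ≤ n)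
    {S : Finset (J × K)} (hτ : 0 < τ) (hθ : ∀ j k, (j, k) ∉ S → ENNReal.ofReal τ ≤ θ j k)
    (hM : 1 ≤ M) (hcard : (S.card : ℝ) ≤ M) (hκ1 : 1 ≤ κ)
    (hκ2 : 16 * (2 * (A + A ^ 2)) / β ≤ κ)
    (hκ3 : 512 * (2 * (A + A ^ 2)) ^ 2 / (α * β ^ 2) ≤ κ)
    (hκ4 : 512 * (2 * (A + A ^ 2)) / (α * β ^ 2) ≤ κ)
    (hsep : κ * √M ≤ N * (ρ ^ 2 - r ^ 2 / τ ^ 2)) :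
    minimaxRisk p q n α θ r A ρ ≤ ENNReal.ofReal (α + β) := by
  obtain ⟨Φ, hΦ, hlaw⟩ := exists_splitMap hN (measurable_kernelVec p q S)
  have hR : MeasurableSet (Φ ⁻¹' vectorRegion S α N) := hΦ (measurableSet_vectorRegion α N)
  rw [minimaxRisk, ENNReal.ofReal_add hα.le hβ.le]
  refine add_le_add le_rfl
    (iInf₂_le_of_le ((Φ ⁻¹' vectorRegion S α N).indicator 1) ⟨?_, fun z => ?_, ?_⟩ ?_)
  · exact measurable_one.indicator hR
  · by_cases hz : z ∈ Φ ⁻¹' vectorRegion S α N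
    · rw [Set.indicator_of_mem hz]; simp
    · rw [Set.indicator_of_notMem hz]; simp
  · refine iSup₂_le fun P hP => ?_
    have hPp : IsProbabilityMeasure P := hP.1
    have hν : IsProbabilityMeasure ((P.prod P).map (kernelVec p q S)) :=
      Measure.isProbabilityMeasure_map (measurable_kernelVec p q S).aemeasurable
    rw [expect_indicator P hR,
      (hlaw P hPp).measure_preimage (measurableSet_vectorRegion α N).nullMeasurableSet]
    exact measure_vectorRegion_le (map_kernelVec_neg p q S hP) hα N
  · refine iSup₂_le fun f hf => ?_
    have hPp := isProbabilityMeasure_densityLaw hf.1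
    have hν : IsProbabilityMeasure
        (((densityLaw μX μY f).prod (densityLaw μX μY f)).map (kernelVec p q S)) :=
      Measure.isProbabilityMeasure_map (measurable_kernelVec p q S).aemeasurable
    obtain ⟨hf1, -, -, hfA, hfX, hfY⟩ := id hf
    obtain ⟨m1, m2, m3⟩ := kernelVec_moments p q S hf1 hfA hfX hfY hA.le
    rw [expect_one_sub_indicator _ hR, ← Set.preimage_compl,
      (hlaw _ hPp).measure_preimage (measurableSet_vectorRegion α N).compl.nullMeasurableSet]
    refine measure_vectorRegion_compl_le m1 m2 m3 (by positivity) hα hα1 hβ hM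
      (by simpa using hcard) hκ1 hκ2 hκ3 hκ4 (hsep.trans ?_)
    have hb := sq_le_sum_add_of_mem_alternatives p q hf hτ hθ
    simp only [dotProduct, ← sq]
    gcongr
    linarith

end Risk

lemma separation_le {α β sX sY A : ℝ} (hα : 0 < α) (hβ : 0 < β) (hαβ : α + β < 1) (hX : 0 < sX)
    (hY : 0 < sY) (hA : 0 < A) : ∃ C : ℝ, 0 < C ∧
      ∀ (X : Type*) (Y : Type*) [MeasurableSpace X] [MeasurableSpace Y]
        (μX : Measure X) (μY : Measure Y) [SigmaFinite μX] [SigmaFinite μY]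
        (p : HilbertBasis Idx ℝ (Lp ℝ 2 μX)) (q : HilbertBasis Idx ℝ (Lp ℝ 2 μY))
        (n : ℕ) (r : ℝ), 16 ≤ n → 0 < r → C ≤ (n : ℝ) * r ^ 2 →
          separation p q n α β (weight sX sY) r A ≤
            ENNReal.ofReal (C * (mZero sX sY ((n : ℝ) * r ^ 2) : ℝ) ^ (1 / 4 : ℝ) /
              (n : ℝ) ^ (1 / 2 : ℝ)) := by
  obtain ⟨C₀, hC₀, hne⟩ := mZeroSet_nonempty hX hY
  set B := 2 * (A + A ^ 2) with hB
  set κ := max (max 1 (16 * B / β)) (max (512 * B ^ 2 / (α * β ^ 2)) (512 * B / (α * β ^ 2)))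
    with hκ
  have hκ1 : 1 ≤ κ := (le_max_left _ _).trans (le_max_left _ _)
  -- The constant has two roles: being at least `C₀` it makes the set defining `mZero` non-empty,
  -- and being at least 8κ + 1 it gives C² - 1 ≥ 8κ, where the 8 comes from ⌊n/4⌋ ≥ n/8.
  refine ⟨max C₀ (8 * κ + 1), lt_max_of_lt_left hC₀, fun X Y _ _ μX μY _ _ p q n r hn hr hC => ?_⟩
  set C := max C₀ (8 * κ + 1) with hCdef
  have hC1 : 8 * κ + 1 ≤ C := le_max_right _ _
  have hC0 : 0 < C := by linarith
  set t := (n : ℝ) * r ^ 2 with ht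
  have ht0 : 0 < t := hC0.trans_le hC
  -- Non-emptiness matters: the infimum of the empty set of naturals would be 0, which is not
  -- admissible.
  have hmem : mZero sX sY t ∈ mZeroSet sX sY t := Nat.sInf_mem (hne t ((le_max_left _ _).trans hC))
  set m := mZero sX sY t
  obtain ⟨hm1, hm2⟩ := hmem
  have hm1' : (1 : ℝ) ≤ m := by exact_mod_cast hm1
  have hm0 : (0 : ℝ) < m := by linarith
  have hn0 : (16 : ℝ) ≤ n := by exact_mod_cast hn
  -- This level gives τ² = t/√m, so the bias r²/τ² equals √m/n, the order of the noise term.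
  obtain ⟨S, hS, hθ⟩ := exists_truncation hX hY (Real.log (t / √(m : ℝ)))
  have hτ : Real.exp (Real.log (t / √(m : ℝ)) / 2) ^ 2 = t / √(m : ℝ) := by
    rw [← Real.exp_nat_mul]
    push_cast
    rw [mul_div_cancel₀ _ two_ne_zero, Real.exp_log (by positivity)]
  set ρ := C * (m : ℝ) ^ (1 / 4 : ℝ) / (n : ℝ) ^ (1 / 2 : ℝ) with hρ
  have hρ0 : 0 < ρ := by positivity
  have hρ2 : ρ ^ 2 = C ^ 2 * √(m : ℝ) / n := by
    rw [hρ, div_pow, mul_pow, ← Real.sqrt_eq_rpow (n : ℝ), Real.sq_sqrt (by positivity),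
      ← Real.rpow_natCast ((m : ℝ) ^ (1 / 4 : ℝ)), ← Real.rpow_mul hm0.le, Real.sqrt_eq_rpow]
    norm_num
  have hN : (n : ℝ) / 8 ≤ ((n / 4 : ℕ) : ℝ) := by
    have h : n ≤ 8 * (n / 4) := by lia
    have : (n : ℝ) ≤ 8 * ((n / 4 : ℕ) : ℝ) := by exact_mod_cast h
    linarith
  have hr2 : r ^ 2 / (t / √(m : ℝ)) = √(m : ℝ) / n := by
    rw [ht]; field_simp
  refine iInf_le_of_le ρ (iInf_le_of_le hρ0 (iInf_le_of_le ?_ le_rfl))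
  refine minimaxRisk_le p q (M := m) (κ := κ) (N := n / 4) hα (by linarith) hβ hA (by lia)
    (Real.exp_pos _) hθ hm1' (by linarith) hκ1 ((le_max_right _ _).trans (le_max_left _ _))
    ((le_max_left _ _).trans (le_max_right _ _)) ((le_max_right _ _).trans (le_max_right _ _)) ?_
  rw [hτ, hρ2, hr2]
  have hCsq : 8 * κ ≤ C ^ 2 - 1 := by nlinarith
  calc κ * √(m : ℝ) = (n : ℝ) / 8 * (8 * κ * √(m : ℝ) / n) := by field_simp
    _ ≤ (n : ℝ) / 8 * ((C ^ 2 - 1) * √(m : ℝ) / n) := by gcongr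
    _ ≤ ((n / 4 : ℕ) : ℝ) * ((C ^ 2 - 1) * √(m : ℝ) / n) :=
        mul_le_mul_of_nonneg_right hN (div_nonneg (mul_nonneg (by linarith) (by positivity))
          (by positivity))
    _ = _ := by ring

end IndepTest

theorem mainTheorem7 :
    -- upper bound on the minimax separation radius
    (∀ α β sX sY A : ℝ, 0 < α → 0 < β → α + β < 1 → 0 < sX → 0 < sY → 0 < A →
      ∃ C : ℝ, 0 < C ∧
        ∀ (X : Type*) (Y : Type*) [MeasurableSpace X] [MeasurableSpace Y]
          (μX : Measure X) (μY : Measure Y) [SigmaFinite μX] [SigmaFinite μY]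
          (p : HilbertBasis IndepTest.Idx ℝ (Lp ℝ 2 μX))
          (q : HilbertBasis IndepTest.Idx ℝ (Lp ℝ 2 μY))
          (n : ℕ) (r : ℝ), 16 ≤ n → 0 < r → C ≤ (n : ℝ) * r ^ 2 →
            IndepTest.separation p q n α β (IndepTest.weight sX sY) r A ≤
              ENNReal.ofReal
                (C * (IndepTest.mZero sX sY ((n : ℝ) * r ^ 2) : ℝ) ^ (1 / 4 : ℝ) /
                  (n : ℝ) ^ (1 / 2 : ℝ))) ∧
    -- growth of `m_{0,s_X,s_Y}`
    (∀ sX sY s ε : ℝ, 0 < sX → 0 < sY → s = 2 / (sX⁻¹ + sY⁻¹) → 0 < ε → ε < 4 * s →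
      ∃ C' : ℝ, 0 < C' ∧ ∀ t : ℝ, C' ≤ t →
        t ^ ((2 * IndepTest.cZero - ε) / (2 * s + IndepTest.cZero)) ≤
            (IndepTest.mZero sX sY t : ℝ) ∧
          (IndepTest.mZero sX sY t : ℝ) ≤
            t ^ ((2 * IndepTest.cZero + ε) / (2 * s + IndepTest.cZero))) ∧
    -- the series for `c₀` converges, and `c₀ = 2.16…`
    (Summable IndepTest.cZeroTerm ∧ 2.16 ≤ IndepTest.cZero ∧ IndepTest.cZero < 2.17) :=
  ⟨fun _ _ _ _ _ hα hβ hαβ hX hY hA => IndepTest.separation_le hα hβ hαβ hX hY hA,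
    fun _ _ _ _ hX hY hs hε hε' => IndepTest.mZero_growth hX hY hs hε hε',
    IndepTest.hasSum_cZeroTerm.summable, IndepTest.le_cZero, IndepTest.cZero_lt⟩
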